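/- Let $T$ be the ternary rooted tree, whose vertices are the finite words over $\{1,2,3\}$ (level $n$ consists of the words of length $n$), and let $\mathrm{Aut}(T)$ be the group of graph automorphisms of $T$ fixing the root. Equip it with the congruence topology, in which the level stabilizers $\mathrm{St}(n)$ form a base of neighbourhoods of the identity. The Hanoi towers group on 3 pegs is the subgroup $\mathcal{H}=\langle a,b,c\rangle\le\mathrm{Aut}(T)$ with $$a=(a,1,1)(2,3),\qquad b=(1,b,1)(1,3),\qquad c=(1,1,c)(1,2),$$ where $g=(g_1,g_2,g_3)\sigma$ means $g(xw)=\sigma(x)\,g_x(w)$ for all letters $x$ and words $w$. Let $\overline{\mathcal{H}}$ be its closure in $\mathrm{Aut}(T)$, with the induced topology. For an integer $D\ge 1$, let $T^D$ be the tree $T$ truncated to the words of length at most $D$. For $g\in\mathrm{Aut}(T)$ and a vertex $v$, let $g|_v\in\mathrm{Aut}(T)$ be the section defined by $g(vw)=g(v)\,g|_v(w)$, and let $g|_v^D\in\mathrm{Aut}(T^D)$ be its restriction to $T^D$. A subgroup of $\mathrm{Aut}(T)$ is a group of finite type of depth $D$ if it equals $$G_{\mathcal P}=\{g\in\mathrm{Aut}(T):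 g|_v^D\in\mathcal P\text{ for all vertices }v\}$$ for some subgroup $\mathcal P\le\mathrm{Aut}(T^D)$. Then: 1. $\overline{\mathcal{H}}$ is a group of finite type of depth $2$, and it is not a group of finite type of depth $1$. 2. $\overline{\mathcal{H}}$ is just-infinite as a topological group: it is infinite and every nontrivial closed normal subgroup has finite index. 3. $\overline{\mathcal{H}}$ is strongly complete: every subgroup of finite index is open. 4. $\mathcal{H}$ itself is not just-infinite as an abstract group: it is infinite and has a nontrivial normal subgroup of infinite index. -/

import Mathlib

/-- The rooted automorphisms of a graph `G` with root `r`: the graph automorphisms fixing `r`. -/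
def rootedAut {V : Type*} (G : SimpleGraph V) (r : V) : Subgroup (G ≃g G) where
  carrier := {g | g r = r}
  one_mem' := rfl
  mul_mem' := by
    intro g h hg hh
    change g (h r) = r
    rw [show h r = r from hh, show g r = r from hg]
  inv_mem' := by
    intro g hg
    change g.symm r = r
    rw [RelIso.symm_apply_eq]
    exact (show g r = r from hg).symm

/-- The regular rooted tree over the alphabet `X`: the vertices are the finite words over `X`, the
root is the empty word, and a word `w` is joined to its children `w ++ [x]`, `x ∈ X`.
For `X = Fin d` this is the `d`-regular rooted tree, and level `n` is the set of words of
length `n`. -/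
def regularTree (X : Type*) : SimpleGraph (List X) where
  Adj u v := (∃ x, v = u ++ [x]) ∨ (∃ x, u = v ++ [x])
  symm := ⟨fun _ _ h => h.symm⟩
  loopless := ⟨fun u h => by
    rcases h with ⟨x, h⟩ | ⟨x, h⟩ <;> simpa using congrArg List.length h⟩

/-- The tree truncated at level `n`: the full subgraph on the words of length at most `n`. -/
def truncTree (X : Type*) (n : ℕ) : SimpleGraph {w : List X // w.length ≤ n} :=
  (regularTree X).comap Subtype.val

/-- `Aut(T)` for the regular rooted tree `T` over `X`. The product is composition of maps, so
the action on vertices is a left action. -/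
abbrev TreeAut (X : Type*) : Type _ := ↥(rootedAut (regularTree X) [])

/-- `Aut(Tⁿ)` for the truncated tree `Tⁿ`. -/
abbrev TruncAut (X : Type*) (n : ℕ) : Type _ :=
  ↥(rootedAut (truncTree X n) ⟨[], Nat.zero_le n⟩)

namespace TreeAut

variable {X : Type*}

/-- The image `g(w)` of a vertex `w`. -/
def app (g : TreeAut X) (w : List X) : List X := g.1 w

theorem app_nil (g : TreeAut X) : g.app [] = [] := g.2

theorem app_mul (g h : TreeAut X) (w : List X) : (g * h).app w = g.app (h.app w) := rfl

theorem app_one (w : List X) : (1 : TreeAut X).app w = w := rfl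

theorem app_inv_app (g : TreeAut X) (w : List X) : g⁻¹.app (g.app w) = w := by
  rw [← app_mul, inv_mul_cancel, app_one]

theorem app_app_inv (g : TreeAut X) (w : List X) : g.app (g⁻¹.app w) = w := by
  rw [← app_mul, mul_inv_cancel, app_one]

theorem app_injective (g : TreeAut X) : Function.Injective g.app := g.1.injective

@[ext] theorem ext {g h : TreeAut X} (H : ∀ w, g.app w = h.app w) : g = h :=
  Subtype.ext (RelIso.ext H)

theorem app_adj (g : TreeAut X) {u v : List X} :
    (regularTree X).Adj (g.app u) (g.app v) ↔ (regularTree X).Adj u v :=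
  g.1.map_rel_iff

theorem app_concat (g : TreeAut X) (w : List X) : ∀ x, ∃ y, g.app (w ++ [x]) = g.app w ++ [y] := by
  induction w using List.reverseRecOn with
  | nil =>
    intro x
    have h : (regularTree X).Adj (g.app []) (g.app ([] ++ [x])) :=
      g.app_adj.2 (Or.inl ⟨x, rfl⟩)
    rcases h with ⟨y, hy⟩ | ⟨y, hy⟩
    · exact ⟨y, hy⟩
    · rw [app_nil] at hy
      simpa using congrArg List.length hy
  | append_singleton w z ih =>
    intro x
    have h : (regularTree X).Adj (g.app (w ++ [z])) (g.app (w ++ [z] ++ [x])) :=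
      g.app_adj.2 (Or.inl ⟨x, rfl⟩)
    rcases h with ⟨y, hy⟩ | ⟨y, hy⟩
    · exact ⟨y, hy⟩
    · obtain ⟨t, ht⟩ := ih z
      rw [ht] at hy
      have h2 := g.app_injective (List.append_inj_left' hy rfl)
      have := congrArg List.length h2
      simp at this

theorem length_app (g : TreeAut X) (w : List X) : (g.app w).length = w.length := by
  induction w using List.reverseRecOn with
  | nil => rw [app_nil]
  | append_singleton w x ih =>
    obtain ⟨y, hy⟩ := g.app_concat w x
    rw [hy]
    simp [ih]

theorem app_prefix (g : TreeAut X) (v w : List X) : g.app v <+: g.app (v ++ w) := by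
  induction w using List.reverseRecOn with
  | nil => simp
  | append_singleton w x ih =>
    obtain ⟨y, hy⟩ := g.app_concat (v ++ w) x
    rw [← List.append_assoc, hy]
    exact ih.trans (List.prefix_append _ _)

/-- The underlying map of the section `g|_v`: remove from `g(vw)` its initial segment `g(v)`. -/
def sectionFun (g : TreeAut X) (v w : List X) : List X := (g.app (v ++ w)).drop v.length

theorem app_append (g : TreeAut X) (v w : List X) :
    g.app (v ++ w) = g.app v ++ g.sectionFun v w := by
  obtain ⟨t, ht⟩ := g.app_prefix v w
  rw [sectionFun, ← ht, ← g.length_app v, List.drop_left]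

theorem sectionFun_mul (g h : TreeAut X) (v w : List X) :
    (g * h).sectionFun v w = g.sectionFun (h.app v) (h.sectionFun v w) := by
  have h1 := (g * h).app_append v w
  rw [app_mul, app_mul, app_append h, app_append g] at h1
  exact (List.append_cancel_left h1).symm

theorem sectionFun_one (v w : List X) : (1 : TreeAut X).sectionFun v w = w := by
  have h1 := (1 : TreeAut X).app_append v w
  rw [app_one, app_one] at h1
  exact (List.append_cancel_left h1).symm

theorem append_adj (v : List X) {u w : List X} :
    (regularTree X).Adj (v ++ u) (v ++ w) ↔ (regularTree X).Adj u w := by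
  simp [regularTree, List.append_assoc]

/-- The section `g|_v`, the automorphism of `T` with `g(vw) = g(v) g|_v(w)` for every word `w`;
here the subtree of words beginning with a given word is identified with `T` by deleting that
word. -/
def sectionAt (g : TreeAut X) (v : List X) : TreeAut X :=
  ⟨{ toFun := g.sectionFun v
     invFun := g⁻¹.sectionFun (g.app v)
     left_inv := fun w => by rw [← sectionFun_mul, inv_mul_cancel, sectionFun_one]
     right_inv := fun w => by
      have h := sectionFun_mul g g⁻¹ (g.app v) w
      rw [mul_inv_cancel, sectionFun_one, app_inv_app] at h
      exact h.symm
     map_rel_iff' := by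
      intro u w
      change (regularTree X).Adj (g.sectionFun v u) (g.sectionFun v w) ↔ _
      rw [← append_adj (g.app v), ← app_append, ← app_append, app_adj, append_adj] },
   by
    change g.sectionFun v [] = []
    have h := g.app_append v []
    rw [List.append_nil] at h
    simpa using h⟩

theorem sectionAt_mul (g h : TreeAut X) (v : List X) :
    (g * h).sectionAt v = g.sectionAt (h.app v) * h.sectionAt v :=
  ext fun w => sectionFun_mul g h v w

theorem sectionAt_one (v : List X) : (1 : TreeAut X).sectionAt v = 1 :=
  ext fun w => sectionFun_one v w

theorem sectionAt_inv (g : TreeAut X) (v : List X) :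
    g⁻¹.sectionAt v = (g.sectionAt (g⁻¹.app v))⁻¹ := by
  rw [eq_inv_iff_mul_eq_one]
  have h := sectionAt_mul g⁻¹ g (g⁻¹.app v)
  rw [inv_mul_cancel, sectionAt_one, app_app_inv] at h
  exact h.symm

/-- `π_n : Aut(T) → Aut(Tⁿ)`, restriction of the action to the words of length at most `n`. -/
def trunc (n : ℕ) : TreeAut X →* TruncAut X n where
  toFun g :=
    ⟨{ toFun := fun w => ⟨g.app w.1, by rw [g.length_app]; exact w.2⟩
       invFun := fun w => ⟨g⁻¹.app w.1, by rw [g⁻¹.length_app]; exact w.2⟩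
       left_inv := fun w => Subtype.ext (g.app_inv_app w.1)
       right_inv := fun w => Subtype.ext (g.app_app_inv w.1)
       map_rel_iff' := g.app_adj },
     Subtype.ext g.app_nil⟩
  map_one' := rfl
  map_mul' _ _ := rfl

/-- The stabilizer `St(n)` of level `n`. -/
def levelStab (X : Type*) (n : ℕ) : Subgroup (TreeAut X) where
  carrier := {g | ∀ v : List X, v.length = n → g.app v = v}
  one_mem' _ _ := rfl
  mul_mem' := by
    intro g h hg hh v hv
    rw [app_mul, hh v hv, hg v hv]
  inv_mem' := by
    intro g hg v hv
    apply g.app_injective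
    rw [app_app_inv, hg v hv]

theorem mem_levelStab {n : ℕ} {g : TreeAut X} :
    g ∈ levelStab X n ↔ ∀ v : List X, v.length = n → g.app v = v := Iff.rfl

theorem levelStab_antitone : Antitone (levelStab X) := by
  intro m n hmn g hg v hv
  rcases v with _ | ⟨x, v⟩
  · exact g.app_nil
  · have h := hg ((x :: v) ++ List.replicate (n - m) x)
      (by rw [List.length_append, hv, List.length_replicate]; omega)
    rw [app_append] at h
    exact List.append_inj_left h (g.length_app _)

theorem levelStab_normal (n : ℕ) : (levelStab X n).Normal := by
  refine ⟨fun g hg h v hv => ?_⟩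
  rw [app_mul, app_mul, hg _ (by rw [length_app, hv]), app_app_inv]

/-- The level stabilizers as a base of neighbourhoods of the identity. -/
@[reducible] def congruenceBasis (X : Type*) : GroupFilterBasis (TreeAut X) where
  sets := Set.range fun n : ℕ => (levelStab X n : Set (TreeAut X))
  nonempty := Set.range_nonempty _
  inter_sets := by
    rintro _ _ ⟨m, rfl⟩ ⟨n, rfl⟩
    exact ⟨_, ⟨max m n, rfl⟩, Set.subset_inter (levelStab_antitone (le_max_left m n))
      (levelStab_antitone (le_max_right m n))⟩
  one' := by
    rintro _ ⟨n, rfl⟩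
    exact one_mem _
  mul' := by
    rintro _ ⟨n, rfl⟩
    refine ⟨_, ⟨n, rfl⟩, ?_⟩
    rintro _ ⟨g, hg, h, hh, rfl⟩
    exact mul_mem hg hh
  inv' := by
    rintro _ ⟨n, rfl⟩
    exact ⟨_, ⟨n, rfl⟩, fun g hg => inv_mem hg⟩
  conj' := by
    rintro g _ ⟨n, rfl⟩
    exact ⟨_, ⟨n, rfl⟩, fun h hh => (levelStab_normal n).conj_mem h hh g⟩

/-- The congruence topology on `Aut(T)`. -/
instance instTopologicalSpace : TopologicalSpace (TreeAut X) := (congruenceBasis X).topology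

instance instIsTopologicalGroup : IsTopologicalGroup (TreeAut X) :=
  (congruenceBasis X).isTopologicalGroup

/-- The group of finite type `G_P` with set of patterns `P ≤ Aut(T^D)`: all `g ∈ Aut(T)` such that
`g|_v^D`, the section of `g` at `v` truncated to `D` levels, lies in `P` for every vertex `v`. -/
def finiteTypeGroup {D : ℕ} (P : Subgroup (TruncAut X D)) : Subgroup (TreeAut X) where
  carrier := {g | ∀ v : List X, trunc D (g.sectionAt v) ∈ P}
  one_mem' v := by
    rw [sectionAt_one, map_one]
    exact one_mem P
  mul_mem' := by
    intro g h hg hh v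
    rw [sectionAt_mul, map_mul]
    exact mul_mem (hg _) (hh v)
  inv_mem' := by
    intro g hg v
    rw [sectionAt_inv, map_inv]
    exact inv_mem (hg _)

/-- A group `G ≤ Aut(T)` is of finite type of depth `D`, with `D` positive, if it is `G_P` for some
`P ≤ Aut(T^D)`. -/
def IsFiniteTypeOfDepth (G : Subgroup (TreeAut X)) (D : ℕ) : Prop :=
  0 < D ∧ ∃ P : Subgroup (TruncAut X D), G = finiteTypeGroup P

end TreeAut

/-- A topological group is just-infinite if it is infinite and every nontrivial closed normal
subgroup has finite index. -/
def IsTopJustInfinite (G : Type*) [Group G] [TopologicalSpace G] : Prop :=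
  Infinite G ∧ ∀ N : Subgroup G, N.Normal → IsClosed (N : Set G) → N ≠ ⊥ → N.FiniteIndex

/-- An abstract group is just-infinite if it is infinite and every nontrivial normal subgroup has
finite index. -/
def IsJustInfinite (G : Type*) [Group G] : Prop :=
  Infinite G ∧ ∀ N : Subgroup G, N.Normal → N ≠ ⊥ → N.FiniteIndex

/-- A profinite group is strongly complete if every subgroup of finite index is open. -/
def IsStronglyComplete (G : Type*) [Group G] [TopologicalSpace G] : Prop :=
  ∀ K : Subgroup G, K.FiniteIndex → IsOpen (K : Set G)

/-- The generator of the Hanoi towers group belonging to the peg `i`. At the first letter it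
exchanges the two letters other than `i`; its section at the letter `i` is itself, and its sections
at the other two letters are trivial. With the pegs `0, 1, 2` for `1, 2, 3`, the maps for
`i = 0, 1, 2` are `a = (a,1,1)(2,3)`, `b = (1,b,1)(1,3)` and `c = (1,1,c)(1,2)`. -/
def hanoiFun (i : Fin 3) : List (Fin 3) → List (Fin 3)
  | [] => []
  | j :: w => if j = i then i :: hanoiFun i w else Equiv.swap (i + 1) (i + 2) j :: w

theorem hanoiFun_hanoiFun (i : Fin 3) (w : List (Fin 3)) : hanoiFun i (hanoiFun i w) = w := by
  induction w with
  | nil => rfl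
  | cons j w ih =>
    by_cases h : j = i
    · simp [hanoiFun, h, ih]
    · have h2 : Equiv.swap (i + 1) (i + 2) j ≠ i := by
        clear ih
        revert i j
        decide
      simp [hanoiFun, h, h2]

theorem hanoiFun_concat (i : Fin 3) (w : List (Fin 3)) (x : Fin 3) :
    ∃ y, hanoiFun i (w ++ [x]) = hanoiFun i w ++ [y] := by
  induction w with
  | nil => by_cases h : x = i <;> simp [hanoiFun, h]
  | cons j w ih =>
    obtain ⟨y, hy⟩ := ih
    by_cases h : j = i <;> simp [hanoiFun, h, hy]

theorem hanoiFun_adj (i : Fin 3) {u v : List (Fin 3)} (h : (regularTree (Fin 3)).Adj u v) :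
    (regularTree (Fin 3)).Adj (hanoiFun i u) (hanoiFun i v) := by
  rcases h with ⟨x, rfl⟩ | ⟨x, rfl⟩
  · exact Or.inl (hanoiFun_concat i u x)
  · exact Or.inr (hanoiFun_concat i v x)

/-- The generator `hanoiFun i` as an automorphism of the ternary rooted tree. -/
def hanoiGen (i : Fin 3) : TreeAut (Fin 3) :=
  ⟨{ toFun := hanoiFun i
     invFun := hanoiFun i
     left_inv := hanoiFun_hanoiFun i
     right_inv := hanoiFun_hanoiFun i
     map_rel_iff' := by
      intro u v
      refine ⟨fun h => ?_, hanoiFun_adj i⟩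
      have h2 := hanoiFun_adj i h
      simpa [hanoiFun_hanoiFun] using h2 },
   rfl⟩

/-- The Hanoi towers group on 3 pegs. -/
def hanoiGroup : Subgroup (TreeAut (Fin 3)) :=
  Subgroup.closure {hanoiGen 0, hanoiGen 1, hanoiGen 2}

/-!
Let `G` be the group of all tree automorphisms `g` such that, at every vertex `v`, the sign of the
permutation of the children of `v` induced by `g` is the product of the signs of `g` at these
children (`parityGroup`). Let `E ≤ G` be the subgroup of elements that are even at the root.

**The closure of the Hanoi group `H` is `G`.** The generators lie in `G`, and `G` is closed. For
the density, `H` is regular branch over `K = [H, H]`: the commutator of the generator of a peg `x`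
with a conjugate of another generator is `[x, y]` placed below the letter `x`
(`exists_section_hanoiGen`, `base_mulSingle_mem_commutator`). All squares lie in `K`, so `K`
realizes every even permutation of the first level and every sign pattern of total sign `1` on the
first level. Hence `K` is dense in `E`, level by level. The condition defining `G` concerns two
consecutive levels, so `G` is of finite type of depth `2`. Depth `1` is impossible, as `G` induces
all permutations of the first level but does not contain the rooted transpositions.

**Every nontrivial normal subgroup of `G`, closed or not, is open.** The key is that every element
of `E` is a product of two commutators of elements of `G`. Modulo the stabilizer of level `n` this
is an induction on `n`: in the wreath recursion a single commutator with a lift of a three-cycle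
reduces `(f₀, f₁, f₂)` to the product of the `fₓ` around the cycle. This product is a product of
two commutators one level lower, and these are placed below two different letters inside one
commutator (`base_mem_twoCommutators`). The signs are corrected below the third letter, by a
commuting pair. The group `G` is compact, so the exact statement follows. It gives that the
abstract commutator subgroup `[E, E]` contains `E × E × E`. If now `N` is normal and `g ∈ N` moves
a vertex `v`, double commutators with `g` put a copy of `[E, E]` below `v` into `N`, and by
transitivity of `G` on the levels `N` contains a level stabilizer of `G`. So `G` is just-infinite,
and, applying this to the normal core of a subgroup of finite index, strongly complete.

**`H` is not just-infinite.** Killing the generator of the peg `2` and sending the other two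
generators to different reflections defines a homomorphism from `H` onto an infinite dihedral
group. On words, the translation part satisfies `τ(u) = τ(u₀) + τ(u₁) - τ(u₂)`, where the `uₓ` are
the sections of `u` (`dihedralShift_eq`). As the sections of a word are shorter, `τ` vanishes on
the words that are trivial in `H`. The kernel is nontrivial and of infinite index.
-/

open scoped commutatorElement

/-! ### Wreath recursion for tree automorphisms -/

namespace TreeAut

section Wreath

variable {X : Type*}

theorem app_append_sectionAt (g : TreeAut X) (v w : List X) :
    g.app (v ++ w) = g.app v ++ (g.sectionAt v).app w := g.app_append v w

theorem sectionAt_nil (g : TreeAut X) : g.sectionAt [] = g :=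
  ext fun _ => rfl

theorem sectionAt_append (g : TreeAut X) (u v : List X) :
    g.sectionAt (u ++ v) = (g.sectionAt u).sectionAt v := by
  ext1 w
  have h := g.app_append_sectionAt (u ++ v) w
  rw [List.append_assoc, app_append_sectionAt g u, app_append_sectionAt _ v w,
    app_append_sectionAt g u v, List.append_assoc] at h
  exact (List.append_cancel_left (List.append_cancel_left h)).symm

theorem sectionAt_cons (g : TreeAut X) (x : X) (v : List X) :
    g.sectionAt (x :: v) = (g.sectionAt [x]).sectionAt v :=
  g.sectionAt_append [x] v

theorem app_singleton_headD (g : TreeAut X) (x : X) : g.app [x] = [(g.app [x]).headD x] := by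
  obtain ⟨y, hy⟩ := List.length_eq_one_iff.1 (g.length_app [x])
  rw [hy]
  rfl

/-- The action of an automorphism on the first level, as a homomorphism to the permutations of
the alphabet. -/
def rootPerm : TreeAut X →* Equiv.Perm X where
  toFun g :=
    { toFun := fun x => (g.app [x]).headD x
      invFun := fun x => (g⁻¹.app [x]).headD x
      left_inv := fun x => by
        rw [← List.singleton_inj, ← app_singleton_headD, ← app_singleton_headD, app_inv_app]
      right_inv := fun x => by
        rw [← List.singleton_inj, ← app_singleton_headD, ← app_singleton_headD, app_app_inv] }
  map_one' := rfl
  map_mul' g h := by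
    ext x
    change ((g * h).app [x]).headD x = (g.app [(h.app [x]).headD x]).headD ((h.app [x]).headD x)
    rw [← List.singleton_inj, ← app_singleton_headD, ← app_singleton_headD, app_mul,
      ← app_singleton_headD]

theorem app_singleton (g : TreeAut X) (x : X) : g.app [x] = [rootPerm g x] :=
  app_singleton_headD g x

theorem app_cons (g : TreeAut X) (x : X) (w : List X) :
    g.app (x :: w) = rootPerm g x :: (g.sectionAt [x]).app w := by
  have h := g.app_append_sectionAt [x] w
  rwa [app_singleton] at h

theorem sectionAt_singleton_mul (g h : TreeAut X) (x : X) :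
    (g * h).sectionAt [x] = g.sectionAt [rootPerm h x] * h.sectionAt [x] := by
  rw [sectionAt_mul, app_singleton]

/-- The map on words given by a permutation `σ` of the first letter, followed by the
automorphisms `f x` of the subtrees. -/
def wreathFun (σ : Equiv.Perm X) (f : X → TreeAut X) : List X → List X
  | [] => []
  | x :: w => σ x :: (f x).app w

theorem wreathFun_adj (σ : Equiv.Perm X) (f : X → TreeAut X) {u v : List X}
    (h : (regularTree X).Adj u v) :
    (regularTree X).Adj (wreathFun σ f u) (wreathFun σ f v) := by
  have key : ∀ (w : List X) (x : X), ∃ y, wreathFun σ f (w ++ [x]) = wreathFun σ f w ++ [y] := by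
    rintro (_ | ⟨z, w⟩) x
    · exact ⟨σ x, by simp [wreathFun, app_nil]⟩
    · obtain ⟨y, hy⟩ := (f z).app_concat w x
      exact ⟨y, by simp [wreathFun, hy]⟩
  rcases h with ⟨x, rfl⟩ | ⟨x, rfl⟩
  · exact Or.inl (key u x)
  · exact Or.inr (key v x)

/-- The automorphism `(f x)_x σ`, which sends the word `xw` to `σ(x) f_x(w)`. -/
def wreath (σ : Equiv.Perm X) (f : X → TreeAut X) : TreeAut X :=
  have h1 : Function.LeftInverse (wreathFun σ⁻¹ fun x => (f (σ⁻¹ x))⁻¹) (wreathFun σ f) := by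
    rintro (_ | ⟨x, w⟩)
    · rfl
    · simp [wreathFun, app_inv_app]
  have h2 : Function.RightInverse (wreathFun σ⁻¹ fun x => (f (σ⁻¹ x))⁻¹) (wreathFun σ f) := by
    rintro (_ | ⟨x, w⟩)
    · rfl
    · simp [wreathFun, app_app_inv]
  ⟨{ toFun := wreathFun σ f
     invFun := wreathFun σ⁻¹ fun x => (f (σ⁻¹ x))⁻¹
     left_inv := h1
     right_inv := h2
     map_rel_iff' := by
      intro u v
      refine ⟨fun h => ?_, wreathFun_adj σ f⟩
      have h3 := wreathFun_adj σ⁻¹ (fun x => (f (σ⁻¹ x))⁻¹) h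
      simpa only [Equiv.coe_fn_mk, h1 u, h1 v] using h3 },
   rfl⟩

@[simp] theorem wreath_app_cons (σ : Equiv.Perm X) (f : X → TreeAut X) (x : X) (w : List X) :
    (wreath σ f).app (x :: w) = σ x :: (f x).app w := rfl

@[simp] theorem rootPerm_wreath (σ : Equiv.Perm X) (f : X → TreeAut X) :
    rootPerm (wreath σ f) = σ := by
  ext x
  have h := app_singleton (wreath σ f) x
  rw [wreath_app_cons, app_nil, List.singleton_inj] at h
  exact h.symm

@[simp] theorem sectionAt_wreath (σ : Equiv.Perm X) (f : X → TreeAut X) (x : X) :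
    (wreath σ f).sectionAt [x] = f x :=
  ext fun _ => rfl

theorem eq_wreath (g : TreeAut X) : g = wreath (rootPerm g) fun x => g.sectionAt [x] := by
  ext1 w
  rcases w with _ | ⟨x, w⟩
  · rw [app_nil, app_nil]
  · rw [app_cons, wreath_app_cons]

theorem ext_wreath {g h : TreeAut X} (h1 : rootPerm g = rootPerm h)
    (h2 : ∀ x, g.sectionAt [x] = h.sectionAt [x]) : g = h := by
  rw [eq_wreath g, eq_wreath h, h1, funext h2]

theorem wreath_mul (σ τ : Equiv.Perm X) (f g : X → TreeAut X) :
    wreath σ f * wreath τ g = wreath (σ * τ) fun x => f (τ x) * g x :=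
  ext_wreath (by simp) fun x => by rw [sectionAt_singleton_mul]; simp

theorem wreath_one : wreath (1 : Equiv.Perm X) (1 : X → TreeAut X) = 1 :=
  ext_wreath (by simp) fun x => by simp [sectionAt_one]

/-- The automorphism of the tree that fixes the first level and acts as `f x` on the subtree
below `x`. -/
def base : (X → TreeAut X) →* TreeAut X where
  toFun f := wreath 1 f
  map_one' := wreath_one
  map_mul' f g := by rw [wreath_mul]; rfl

/-- The rooted automorphism that permutes the subtrees below the first level rigidly. -/
def rooted : Equiv.Perm X →* TreeAut X where
  toFun σ := wreath σ 1
  map_one' := wreath_one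
  map_mul' σ τ := by rw [wreath_mul]; simp [Pi.one_def]

theorem base_apply (f : X → TreeAut X) : base f = wreath 1 f := rfl

theorem rooted_apply (σ : Equiv.Perm X) : rooted σ = wreath σ 1 := rfl

@[simp] theorem rootPerm_base (f : X → TreeAut X) : rootPerm (base f) = 1 := rootPerm_wreath _ _

@[simp] theorem rootPerm_rooted (σ : Equiv.Perm X) : rootPerm (rooted σ) = σ := rootPerm_wreath _ _

@[simp] theorem sectionAt_base (f : X → TreeAut X) (x : X) : (base f).sectionAt [x] = f x :=
  sectionAt_wreath _ _ _

@[simp] theorem sectionAt_rooted (σ : Equiv.Perm X) (x : X) : (rooted σ).sectionAt [x] = 1 :=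
  sectionAt_wreath _ _ _

theorem rooted_mul_base (σ : Equiv.Perm X) (f : X → TreeAut X) :
    rooted σ * base f = base (fun x => f (σ⁻¹ x)) * rooted σ := by
  rw [rooted_apply, base_apply, base_apply, wreath_mul, wreath_mul]
  simp

theorem eq_base_mul_rooted (g : TreeAut X) :
    g = base (fun x => g.sectionAt [(rootPerm g)⁻¹ x]) * rooted (rootPerm g) := by
  conv_lhs => rw [eq_wreath g]
  rw [base_apply, rooted_apply, wreath_mul]
  simp

theorem eq_base {g : TreeAut X} (h : rootPerm g = 1) : g = base fun x => g.sectionAt [x] := by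
  conv_lhs => rw [eq_wreath g, h]
  rfl

/-- The automorphism that acts as `g` on the subtree below the vertex `v` and fixes every vertex
outside that subtree. -/
def atVertex [DecidableEq X] : List X → TreeAut X →* TreeAut X
  | [] => MonoidHom.id _
  | x :: v => (base.comp (MonoidHom.mulSingle (fun _ : X => TreeAut X) x)).comp (atVertex v)

section

variable [DecidableEq X]

@[simp] theorem atVertex_nil (g : TreeAut X) : atVertex [] g = g := rfl

theorem atVertex_cons (x : X) (v : List X) (g : TreeAut X) :
    atVertex (x :: v) g = base (Pi.mulSingle x (atVertex v g)) := rfl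

theorem atVertex_singleton (x : X) (g : TreeAut X) : atVertex [x] g = base (Pi.mulSingle x g) :=
  rfl

theorem atVertex_append (u v : List X) (g : TreeAut X) :
    atVertex (u ++ v) g = atVertex u (atVertex v g) := by
  induction u with
  | nil => rfl
  | cons x u ih => rw [List.cons_append, atVertex_cons, ih, atVertex_cons]

theorem conj_base_mulSingle (h : TreeAut X) (x : X) (g : TreeAut X) :
    h * base (Pi.mulSingle x g) * h⁻¹ =
      base (Pi.mulSingle (rootPerm h x) (h.sectionAt [x] * g * (h.sectionAt [x])⁻¹)) := by
  rw [mul_inv_eq_iff_eq_mul]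
  refine ext_wreath (by simp) fun y => ?_
  rw [sectionAt_singleton_mul, sectionAt_singleton_mul]
  by_cases hy : y = x
  · subst hy
    simp
  · simp [Pi.mulSingle_eq_of_ne, hy]

theorem conj_atVertex (h : TreeAut X) (v : List X) (g : TreeAut X) :
    h * atVertex v g * h⁻¹ =
      atVertex (h.app v) (h.sectionAt v * g * (h.sectionAt v)⁻¹) := by
  induction v generalizing h with
  | nil => simp [app_nil, sectionAt_nil]
  | cons x v ih =>
    rw [atVertex_cons, conj_base_mulSingle, ih, app_cons, atVertex_cons, sectionAt_cons h x v]

/-- Elements supported below two different vertices of the same level commute. -/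
theorem commute_atVertex {u v : List X} (h : u.length = v.length) (huv : u ≠ v)
    (g k : TreeAut X) : Commute (atVertex u g) (atVertex v k) := by
  induction u generalizing v with
  | nil =>
    rw [List.length_nil, eq_comm, List.length_eq_zero_iff] at h
    exact absurd h.symm huv
  | cons x u ih =>
    rcases v with _ | ⟨y, v⟩
    · simp at h
    · rw [atVertex_cons, atVertex_cons]
      refine Commute.map ?_ base
      by_cases hxy : x = y
      · subst hxy
        have h1 : u ≠ v := fun h2 => huv (by rw [h2])
        exact (ih (by simpa using h) h1).map (MonoidHom.mulSingle (fun _ : X => TreeAut X) x)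
      · exact Pi.mulSingle_commute hxy _ _

end

end Wreath

/-! ### Levels, topology and compactness -/

section Levels

variable {X : Type*}

/-- Two automorphisms that agree on a level agree on all levels above it. -/
theorem app_eq_of_le {m n : ℕ} (hmn : m ≤ n) {g h : TreeAut X}
    (H : ∀ v : List X, v.length = n → g.app v = h.app v) {v : List X} (hv : v.length = m) :
    g.app v = h.app v := by
  have h1 : h⁻¹ * g ∈ levelStab X n := fun v hv => by rw [app_mul, H v hv, app_inv_app]
  have h2 := levelStab_antitone hmn h1 v hv
  rw [app_mul] at h2
  conv_rhs => rw [← h2]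
  rw [app_app_inv]

theorem sectionAt_app_eq {m n : ℕ} {g h : TreeAut X} {v : List X} (hv : v.length + m = n)
    (H : ∀ w : List X, w.length = n → g.app w = h.app w) {w : List X} (hw : w.length = m) :
    (g.sectionAt v).app w = (h.sectionAt v).app w := by
  have h1 := H (v ++ w) (by simp [hv, hw])
  rw [app_append_sectionAt, app_append_sectionAt,
    app_eq_of_le (by omega : v.length ≤ n) H rfl] at h1
  exact List.append_cancel_left h1

theorem rootPerm_eq {n : ℕ} (hn : 1 ≤ n) {g h : TreeAut X}
    (H : ∀ v : List X, v.length = n → g.app v = h.app v) : rootPerm g = rootPerm h := by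
  ext x
  have h1 := app_eq_of_le hn H (v := [x]) rfl
  rwa [app_singleton, app_singleton, List.singleton_inj] at h1

theorem mem_closure_iff_forall_level {s : Set (TreeAut X)} {g : TreeAut X} :
    g ∈ closure s ↔ ∀ n, ∃ h ∈ s, ∀ v : List X, v.length = n → h.app v = g.app v := by
  rw [mem_closure_iff_nhds_basis' ((congruenceBasis X).nhds_hasBasis g)]
  constructor
  · intro H n
    obtain ⟨_, ⟨k, hk, rfl⟩, hs⟩ := H (levelStab X n : Set (TreeAut X)) ⟨n, rfl⟩
    exact ⟨g * k, hs, fun v hv => by rw [app_mul, hk v hv]⟩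
  · rintro H _ ⟨n, rfl⟩
    obtain ⟨h, hs, hh⟩ := H n
    refine ⟨h, ⟨g⁻¹ * h, fun v hv => ?_, mul_inv_cancel_left g h⟩, hs⟩
    rw [app_mul, hh v hv, app_inv_app]

theorem isOpen_levelStab (n : ℕ) : IsOpen (levelStab X n : Set (TreeAut X)) :=
  Subgroup.isOpen_of_mem_nhds _ (g := 1) ((congruenceBasis X).mem_nhds_one ⟨n, rfl⟩)

instance instT2Space : T2Space (TreeAut X) := by
  suffices T1Space (TreeAut X) from inferInstance
  refine ⟨fun g => ?_⟩
  refine isClosed_of_closure_subset fun h hh => ?_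
  rw [mem_closure_iff_forall_level] at hh
  ext1 v
  obtain ⟨k, hk, hv⟩ := hh v.length
  rw [← hv v rfl, Set.mem_singleton_iff.1 hk]

/-- For a finite alphabet the group of tree automorphisms is compact: along an ultrafilter, the
image of each word is eventually constant, and the limits of these images form an automorphism. -/
instance instCompactSpace [Finite X] : CompactSpace (TreeAut X) := by
  refine ⟨isCompact_iff_ultrafilter_le_nhds.2 fun F _ => ?_⟩
  have lim : ∀ (c : TreeAut X → TreeAut X) (w : List X),
      (∀ g v, (c g).app v ∈ {u : List X | u.length = v.length}) →
      ∃ u, ∀ᶠ g in (F : Filter (TreeAut X)), (c g).app w = u := by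
    intro c w hc
    have hfin : {u : List X | u.length = w.length}.Finite := List.finite_length_eq X w.length
    have h1 : ∀ᶠ g in (F : Filter (TreeAut X)), ∃ u ∈ {u : List X | u.length = w.length},
        (c g).app w = u := Filter.Eventually.of_forall fun g => ⟨_, hc g w, rfl⟩
    obtain ⟨u, -, hu⟩ := (Ultrafilter.eventually_exists_mem_iff hfin).1 h1
    exact ⟨u, hu⟩
  choose L hL using fun w => lim id w fun g v => g.length_app v
  choose M hM using fun w => lim (fun g => g⁻¹) w fun g v => g⁻¹.length_app v
  have hML : ∀ w, M (L w) = w := fun w => by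
    obtain ⟨g, h1, h2⟩ := ((hL w).and (hM (L w))).exists
    rw [← h2, ← h1]
    exact g.app_inv_app w
  have hLM : ∀ w, L (M w) = w := fun w => by
    obtain ⟨g, h1, h2⟩ := ((hM w).and (hL (M w))).exists
    rw [← h2, ← h1]
    exact g.app_app_inv w
  let k : TreeAut X :=
    ⟨{ toFun := L
       invFun := M
       left_inv := hML
       right_inv := hLM
       map_rel_iff' := by
        intro u v
        obtain ⟨g, h1, h2⟩ := ((hL u).and (hL v)).exists
        change (regularTree X).Adj (L u) (L v) ↔ _
        rw [← h1, ← h2]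
        exact g.app_adj },
     by
      change L [] = []
      obtain ⟨g, h1⟩ := (hL []).exists
      rw [← h1]
      exact g.app_nil⟩
  refine ⟨k, Set.mem_univ _, ?_⟩
  rw [((congruenceBasis X).nhds_hasBasis k).ge_iff]
  rintro _ ⟨n, rfl⟩
  have h1 : ∀ᶠ g in (F : Filter (TreeAut X)), ∀ w ∈ {u : List X | u.length = n}, g.app w = L w :=
    (Filter.eventually_all_finite (List.finite_length_eq X n)).2 fun w _ => hL w
  filter_upwards [h1] with g hg
  refine ⟨k⁻¹ * g, fun v hv => ?_, mul_inv_cancel_left k g⟩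
  rw [app_mul, hg v hv]
  exact hML v

end Levels

end TreeAut

/-! ### The parity group -/

namespace TreeAut

section Parity

variable {X : Type*} [Fintype X] [DecidableEq X]

/-- The sign of the permutation of the first level. -/
def rootSign : TreeAut X →* ℤˣ := Equiv.Perm.sign.comp rootPerm

theorem rootSign_apply (g : TreeAut X) : rootSign g = Equiv.Perm.sign (rootPerm g) := rfl

@[simp] theorem rootSign_base (f : X → TreeAut X) : rootSign (base f) = 1 := by
  simp [rootSign_apply]

/-- The parity condition at the root: the sign of `g` at the root is the product of its signs at
the vertices of the first level. -/
def parityPattern (X : Type*) [Fintype X] [DecidableEq X] : Subgroup (TreeAut X) where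
  carrier := {g | rootSign g = ∏ x, rootSign (g.sectionAt [x])}
  one_mem' := by simp [sectionAt_one]
  mul_mem' := by
    intro g h hg hh
    change rootSign g = _ at hg
    change rootSign h = _ at hh
    change rootSign (g * h) = _
    simp only [sectionAt_singleton_mul, map_mul, Finset.prod_mul_distrib]
    rw [hg, hh, Equiv.prod_comp (rootPerm h) fun x => rootSign (g.sectionAt [x])]
  inv_mem' := by
    intro g hg
    change rootSign g = _ at hg
    change rootSign g⁻¹ = _
    simp only [sectionAt_inv, app_singleton, map_inv, Finset.prod_inv_distrib]
    rw [hg, Equiv.prod_comp (rootPerm g)⁻¹ fun x => rootSign (g.sectionAt [x])]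

theorem mem_parityPattern {g : TreeAut X} :
    g ∈ parityPattern X ↔ rootSign g = ∏ x, rootSign (g.sectionAt [x]) := Iff.rfl

/-- The automorphisms all of whose sections satisfy the parity condition at the root. -/
def parityGroup (X : Type*) [Fintype X] [DecidableEq X] : Subgroup (TreeAut X) where
  carrier := {g | ∀ v, g.sectionAt v ∈ parityPattern X}
  one_mem' v := by rw [sectionAt_one]; exact one_mem _
  mul_mem' hg hh v := by rw [sectionAt_mul]; exact mul_mem (hg _) (hh v)
  inv_mem' hg v := by rw [sectionAt_inv]; exact inv_mem (hg _)

theorem sectionAt_mem_parityGroup {g : TreeAut X} (hg : g ∈ parityGroup X) (v : List X) :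
    g.sectionAt v ∈ parityGroup X := fun w => by
  rw [← sectionAt_append]
  exact hg _

theorem mem_parityGroup_iff {g : TreeAut X} :
    g ∈ parityGroup X ↔ g ∈ parityPattern X ∧ ∀ x, g.sectionAt [x] ∈ parityGroup X := by
  refine ⟨fun hg => ⟨by simpa [sectionAt_nil] using hg [], fun x =>
    sectionAt_mem_parityGroup hg [x]⟩, fun hg v => ?_⟩
  rcases v with _ | ⟨x, v⟩
  · rw [sectionAt_nil]
    exact hg.1
  · rw [sectionAt_cons]
    exact hg.2 x v

theorem wreath_mem_parityGroup {σ : Equiv.Perm X} {f : X → TreeAut X} :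
    wreath σ f ∈ parityGroup X ↔
      Equiv.Perm.sign σ = ∏ x, rootSign (f x) ∧ ∀ x, f x ∈ parityGroup X := by
  rw [mem_parityGroup_iff, mem_parityPattern]
  simp [rootSign_apply]

theorem base_mem_parityGroup {f : X → TreeAut X} :
    base f ∈ parityGroup X ↔ ∏ x, rootSign (f x) = 1 ∧ ∀ x, f x ∈ parityGroup X := by
  rw [base_apply, wreath_mem_parityGroup, map_one, eq_comm]

theorem rooted_mem_parityGroup {σ : Equiv.Perm X} :
    rooted σ ∈ parityGroup X ↔ Equiv.Perm.sign σ = 1 := by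
  rw [rooted_apply, wreath_mem_parityGroup]
  simp

/-- An element of the parity group that is even at the root may be placed below any vertex. -/
theorem atVertex_mem_parityGroup {g : TreeAut X} (hg : g ∈ parityGroup X) (h1 : rootSign g = 1)
    (v : List X) : atVertex v g ∈ parityGroup X ∧ rootSign (atVertex v g) = 1 := by
  induction v with
  | nil => exact ⟨hg, h1⟩
  | cons x v ih =>
    rw [atVertex_cons]
    refine ⟨base_mem_parityGroup.2 ⟨?_, fun y => ?_⟩, rootSign_base _⟩
    · refine Finset.prod_eq_one fun y _ => ?_
      by_cases h : y = x
      · subst h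
        rw [Pi.mulSingle_eq_same, ih.2]
      · rw [Pi.mulSingle_eq_of_ne h, map_one]
    · by_cases h : y = x
      · subst h
        rw [Pi.mulSingle_eq_same]
        exact ih.1
      · rw [Pi.mulSingle_eq_of_ne h]
        exact one_mem _

theorem rootSign_eq {n : ℕ} (hn : 1 ≤ n) {g h : TreeAut X}
    (H : ∀ v : List X, v.length = n → g.app v = h.app v) : rootSign g = rootSign h := by
  rw [rootSign_apply, rootSign_apply, rootPerm_eq hn H]

/-- The parity condition at the root only depends on the action on the second level. -/
theorem parityPattern_of_app_eq {g h : TreeAut X}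
    (H : ∀ v : List X, v.length = 2 → g.app v = h.app v) (hg : g ∈ parityPattern X) :
    h ∈ parityPattern X := by
  rw [mem_parityPattern] at hg ⊢
  rw [← rootSign_eq one_le_two H, hg]
  refine Finset.prod_congr rfl fun x _ => rootSign_eq le_rfl fun v hv => ?_
  exact sectionAt_app_eq (v := [x]) rfl H hv

theorem isClosed_parityGroup : IsClosed (parityGroup X : Set (TreeAut X)) := by
  refine isClosed_of_closure_subset fun g hg v => ?_
  obtain ⟨h, hh, H⟩ := mem_closure_iff_forall_level.1 hg (v.length + 2)
  exact parityPattern_of_app_eq (fun w hw => sectionAt_app_eq rfl H hw) (hh v)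

/-- The parity group is the group of finite type whose patterns are the restrictions of its
elements to two levels. -/
theorem parityGroup_eq_finiteTypeGroup :
    parityGroup X = finiteTypeGroup ((parityGroup X).map (trunc 2)) := by
  refine le_antisymm (fun g hg v => ⟨_, sectionAt_mem_parityGroup hg v, rfl⟩) fun g hg v => ?_
  obtain ⟨h, hh, H⟩ := hg v
  refine parityPattern_of_app_eq (fun w hw => ?_) (mem_parityGroup_iff.1 hh).1
  exact congrArg Subtype.val (congrArg (fun k => k.1 ⟨w, hw.le⟩) H)

end Parity

end TreeAut

/-! ### The closure of the Hanoi group -/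

/-- If a subgroup `R` is normalized by the group generated by `S` and contains the commutators of
the elements of `S`, then it contains the commutator subgroup of the group generated by `S`. -/
theorem Subgroup.commutator_closure_le {G : Type*} [Group G] {S : Set G} {R : Subgroup G}
    (hR : ∀ g ∈ closure S, ∀ r ∈ R, g * r * g⁻¹ ∈ R) (hS : ∀ s ∈ S, ∀ t ∈ S, ⁅s, t⁆ ∈ R) :
    ⁅closure S, closure S⁆ ≤ R := by
  have mul_left : ∀ x ∈ closure S, ∀ y z, ⁅x, z⁆ ∈ R → ⁅y, z⁆ ∈ R → ⁅x * y, z⁆ ∈ R := by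
    intro x hx y z h1 h2
    have h3 : ⁅x * y, z⁆ = x * ⁅y, z⁆ * x⁻¹ * ⁅x, z⁆ := by
      simp only [commutatorElement_def]
      group
    rw [h3]
    exact mul_mem (hR x hx _ h2) h1
  have inv_left : ∀ x ∈ closure S, ∀ z, ⁅x, z⁆ ∈ R → ⁅x⁻¹, z⁆ ∈ R := by
    intro x hx z h1
    have h3 : ⁅x⁻¹, z⁆ = x⁻¹ * ⁅x, z⁆⁻¹ * x⁻¹⁻¹ := by
      simp only [commutatorElement_def]
      group
    rw [h3]
    exact hR _ (inv_mem hx) _ (inv_mem h1)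
  have gen : ∀ x ∈ closure S, ∀ t ∈ S, ⁅x, t⁆ ∈ R := by
    intro x hx t ht
    induction hx using closure_induction with
    | mem x hx => exact hS x hx t ht
    | one => simp
    | mul x y hx hy h1 h2 => exact mul_left x hx y t h1 h2
    | inv x hx h1 => exact inv_left x hx t h1
  rw [commutator_le]
  intro x hx y hy
  induction hx using closure_induction with
  | mem x hx =>
    rw [← commutatorElement_inv]
    exact inv_mem (gen y hy x hx)
  | one => simp
  | mul x y hx hy h1 h2 => exact mul_left x hx y _ h1 h2
  | inv x hx h1 => exact inv_left x hx _ h1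

/-- In a group generated by involutions every square is a product of commutators. -/
theorem Subgroup.sq_mem_commutator_closure {G : Type*} [Group G] {S : Set G}
    (hS : ∀ s ∈ S, s * s = 1) {g : G} (hg : g ∈ closure S) :
    g * g ∈ ⁅closure S, closure S⁆ := by
  induction hg using closure_induction with
  | mem s hs => rw [hS s hs]; exact one_mem _
  | one => simp
  | mul x y hx hy h1 h2 =>
    have h3 : x * y * (x * y) = x * x * ⁅x⁻¹, y⁆ * (y * y) := by
      simp only [commutatorElement_def]
      group
    rw [h3]
    exact mul_mem (mul_mem h1 (commutator_mem_commutator (inv_mem hx) hy)) h2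
  | inv x hx h1 =>
    rw [← mul_inv_rev]
    exact inv_mem h1

namespace TreeAut

section Hanoi

theorem hanoiGen_eq_wreath (i : Fin 3) :
    hanoiGen i = wreath (Equiv.swap (i + 1) (i + 2)) (Pi.mulSingle i (hanoiGen i)) := by
  ext1 w
  rcases w with _ | ⟨j, w⟩
  · rfl
  · change hanoiFun i (j :: w) = _
    rw [wreath_app_cons, hanoiFun]
    by_cases h : j = i
    · subst h
      rw [if_pos rfl, Pi.mulSingle_eq_same, Equiv.swap_apply_of_ne_of_ne (by simp) (by simp)]
      rfl
    · rw [if_neg h, Pi.mulSingle_eq_of_ne h, app_one]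

theorem hanoiGen_mul_self (i : Fin 3) : hanoiGen i * hanoiGen i = 1 :=
  ext fun w => hanoiFun_hanoiFun i w

theorem hanoiGen_inv (i : Fin 3) : (hanoiGen i)⁻¹ = hanoiGen i :=
  inv_eq_of_mul_eq_one_right (hanoiGen_mul_self i)

@[simp] theorem rootPerm_hanoiGen (i : Fin 3) :
    rootPerm (hanoiGen i) = Equiv.swap (i + 1) (i + 2) := by
  rw [hanoiGen_eq_wreath, rootPerm_wreath]

theorem sectionAt_hanoiGen (i x : Fin 3) :
    (hanoiGen i).sectionAt [x] = Pi.mulSingle (M := fun _ => TreeAut (Fin 3)) i (hanoiGen i) x := by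
  conv_lhs => rw [hanoiGen_eq_wreath]
  rw [sectionAt_wreath]

@[simp] theorem sectionAt_hanoiGen_self (i : Fin 3) : (hanoiGen i).sectionAt [i] = hanoiGen i := by
  rw [sectionAt_hanoiGen, Pi.mulSingle_eq_same]

theorem sectionAt_hanoiGen_of_ne {i x : Fin 3} (h : x ≠ i) : (hanoiGen i).sectionAt [x] = 1 := by
  rw [sectionAt_hanoiGen, Pi.mulSingle_eq_of_ne h]

@[simp] theorem rootSign_hanoiGen (i : Fin 3) : rootSign (hanoiGen i) = -1 := by
  rw [rootSign_apply, rootPerm_hanoiGen, Equiv.Perm.sign_swap (by simp)]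

theorem hanoiGroup_eq : hanoiGroup = Subgroup.closure (Set.range hanoiGen) := by
  rw [hanoiGroup]
  congr 1
  ext g
  simp [Fin.exists_fin_succ, eq_comm]

theorem hanoiGen_mem (i : Fin 3) : hanoiGen i ∈ hanoiGroup := by
  rw [hanoiGroup_eq]
  exact Subgroup.subset_closure ⟨i, rfl⟩

theorem hanoiGen_mem_parityGroup (i : Fin 3) : hanoiGen i ∈ parityGroup (Fin 3) := by
  intro v
  induction v with
  | nil =>
    rw [sectionAt_nil, mem_parityPattern, rootSign_hanoiGen, Finset.prod_eq_single i]
    · simp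
    · intro x _ hx
      rw [sectionAt_hanoiGen_of_ne hx, map_one]
    · simp
  | cons x v ih =>
    rw [sectionAt_cons]
    by_cases h : x = i
    · rwa [h, sectionAt_hanoiGen_self]
    · rw [sectionAt_hanoiGen_of_ne h, sectionAt_one]
      exact one_mem _

theorem hanoiGroup_le : hanoiGroup ≤ parityGroup (Fin 3) := by
  rw [hanoiGroup_eq, Subgroup.closure_le]
  rintro _ ⟨i, rfl⟩
  exact hanoiGen_mem_parityGroup i

/-- There is an element of the Hanoi group that fixes the letter `x`, whose section there is the
generator of the peg `i`, and whose commutator with the generator of the peg `x` is supported below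
`x`. It is the conjugate of the generator of `i` by that of the peg `k` with `i + x + k = 0` modulo
`3`, the third peg if `i ≠ x`. -/
theorem exists_section_hanoiGen (x i : Fin 3) :
    ∃ h ∈ hanoiGroup, rootPerm h x = x ∧ h.sectionAt [x] = hanoiGen i ∧
      ⁅hanoiGen x, h⁆ = base (Pi.mulSingle x ⁅hanoiGen x, hanoiGen i⁆) := by
  obtain ⟨k, hk⟩ : ∃ k : Fin 3, i + x + k = 0 := ⟨-(i + x), by simp⟩
  refine ⟨hanoiGen k * hanoiGen i * hanoiGen k,
    mul_mem (mul_mem (hanoiGen_mem _) (hanoiGen_mem _)) (hanoiGen_mem _), ?_, ?_, ?_⟩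
  · simp only [map_mul, rootPerm_hanoiGen]
    revert x i k
    decide
  · simp only [sectionAt_singleton_mul, rootPerm_hanoiGen]
    fin_cases x <;> fin_cases i <;> fin_cases k <;>
      first
      | exact absurd hk (by decide)
      | simp [sectionAt_hanoiGen, hanoiGen_mul_self, Equiv.swap_apply_def]
  · refine ext_wreath ?_ fun y => ?_
    · simp only [commutatorElement_def, hanoiGen_inv, mul_inv_rev, map_mul, rootPerm_hanoiGen,
        rootPerm_base]
      revert x i k
      decide
    · simp only [commutatorElement_def, hanoiGen_inv, mul_inv_rev, sectionAt_singleton_mul,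
        rootPerm_hanoiGen, sectionAt_base, map_mul]
      fin_cases x <;> fin_cases i <;> fin_cases k <;>
        first
        | exact absurd hk (by decide)
        | fin_cases y <;> simp [sectionAt_hanoiGen, hanoiGen_mul_self,
            Equiv.swap_apply_def, mul_assoc]

theorem exists_section_eq (x : Fin 3) {g : TreeAut (Fin 3)} (hg : g ∈ hanoiGroup) :
    ∃ h ∈ hanoiGroup, rootPerm h x = x ∧ h.sectionAt [x] = g := by
  rw [hanoiGroup_eq] at hg
  induction hg using Subgroup.closure_induction with
  | mem g hg =>
    obtain ⟨i, rfl⟩ := hg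
    obtain ⟨h, h1, h2, h3, -⟩ := exists_section_hanoiGen x i
    exact ⟨h, h1, h2, h3⟩
  | one => exact ⟨1, one_mem _, by simp, sectionAt_one _⟩
  | mul g g' _ _ ih ih' =>
    obtain ⟨h, h1, h2, h3⟩ := ih
    obtain ⟨h', h1', h2', h3'⟩ := ih'
    exact ⟨h * h', mul_mem h1 h1', by simp [h2, h2'],
      by rw [sectionAt_singleton_mul, h2', h3, h3']⟩
  | inv g _ ih =>
    obtain ⟨h, h1, h2, h3⟩ := ih
    have h4 : rootPerm h⁻¹ x = x := by rw [map_inv, Equiv.Perm.inv_eq_iff_eq, h2]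
    exact ⟨h⁻¹, inv_mem h1, h4, by rw [sectionAt_inv, app_singleton, h4, h3]⟩

theorem conj_mem_commutator_hanoiGroup {g k : TreeAut (Fin 3)} (hg : g ∈ hanoiGroup)
    (hk : k ∈ ⁅hanoiGroup, hanoiGroup⁆) : g * k * g⁻¹ ∈ ⁅hanoiGroup, hanoiGroup⁆ := by
  have hkH : k ∈ hanoiGroup := Subgroup.commutator_le_self hanoiGroup hk
  have h1 : g * k * g⁻¹ = ⁅g, k⁆ * k := by simp [commutatorElement_def]
  rw [h1]
  exact mul_mem (Subgroup.commutator_mem_commutator hg hkH) hk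

/-- The Hanoi group is regular branch over its commutator subgroup. -/
theorem base_mulSingle_mem_commutator (x : Fin 3) {k : TreeAut (Fin 3)}
    (hk : k ∈ ⁅hanoiGroup, hanoiGroup⁆) :
    base (Pi.mulSingle x k) ∈ ⁅hanoiGroup, hanoiGroup⁆ := by
  have key : ∀ i j x : Fin 3,
      base (Pi.mulSingle x ⁅hanoiGen i, hanoiGen j⁆) ∈ ⁅hanoiGroup, hanoiGroup⁆ := by
    have key1 : ∀ x j : Fin 3,
        base (Pi.mulSingle x ⁅hanoiGen x, hanoiGen j⁆) ∈ ⁅hanoiGroup, hanoiGroup⁆ := by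
      intro x j
      obtain ⟨h, h1, -, -, h2⟩ := exists_section_hanoiGen x j
      rw [← h2]
      exact Subgroup.commutator_mem_commutator (hanoiGen_mem x) h1
    intro i j x
    by_cases hxi : x = i
    · subst hxi
      exact key1 x j
    by_cases hxj : x = j
    · subst hxj
      rw [← commutatorElement_inv, Pi.mulSingle_inv, map_inv]
      exact inv_mem (key1 x i)
    by_cases hij : i = j
    · subst hij
      simp
    -- The generator of the peg `j` carries the subtree below `i` rigidly to the one below `x`.
    have h1 : rootPerm (hanoiGen j) i = x := by
      rw [rootPerm_hanoiGen]
      revert i j x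
      decide
    have h2 := conj_base_mulSingle (hanoiGen j) i ⁅hanoiGen i, hanoiGen j⁆
    rw [h1, sectionAt_hanoiGen_of_ne hij, one_mul, inv_one, mul_one] at h2
    rw [← h2]
    exact conj_mem_commutator_hanoiGroup (hanoiGen_mem j) (key1 i j)
  let R : Subgroup (TreeAut (Fin 3)) := ⁅hanoiGroup, hanoiGroup⁆.comap
    (base.comp (MonoidHom.mulSingle (fun _ : Fin 3 => TreeAut (Fin 3)) x))
  have hR : ⁅hanoiGroup, hanoiGroup⁆ ≤ R := by
    rw [hanoiGroup_eq]
    refine Subgroup.commutator_closure_le ?_ ?_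
    · intro g hg r hr
      rw [← hanoiGroup_eq] at hg
      obtain ⟨h, h1, h2, h3⟩ := exists_section_eq x hg
      have h4 := conj_base_mulSingle h x r
      rw [h2, h3] at h4
      change base (Pi.mulSingle x (g * r * g⁻¹)) ∈ ⁅hanoiGroup, hanoiGroup⁆
      rw [← h4]
      exact conj_mem_commutator_hanoiGroup h1 hr
    · rintro _ ⟨i, rfl⟩ _ ⟨j, rfl⟩
      exact key i j x
  exact hR hk

theorem base_mem_commutator {f : Fin 3 → TreeAut (Fin 3)}
    (hf : ∀ x, f x ∈ ⁅hanoiGroup, hanoiGroup⁆) : base f ∈ ⁅hanoiGroup, hanoiGroup⁆ := by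
  have h1 : f = Pi.mulSingle 0 (f 0) * Pi.mulSingle 1 (f 1) * Pi.mulSingle 2 (f 2) := by
    ext1 x
    fin_cases x <;> simp
  rw [h1, map_mul, map_mul]
  exact mul_mem (mul_mem (base_mulSingle_mem_commutator _ (hf 0))
    (base_mulSingle_mem_commutator _ (hf 1))) (base_mulSingle_mem_commutator _ (hf 2))

theorem sq_mem_commutator {g : TreeAut (Fin 3)} (hg : g ∈ hanoiGroup) :
    g * g ∈ ⁅hanoiGroup, hanoiGroup⁆ := by
  rw [hanoiGroup_eq] at hg ⊢
  refine Subgroup.sq_mem_commutator_closure ?_ hg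
  rintro _ ⟨i, rfl⟩
  exact hanoiGen_mul_self i

/-- The elements of the commutator subgroup realize every even permutation of the first level. -/
theorem exists_mem_commutator_rootPerm {σ : Equiv.Perm (Fin 3)} (hσ : Equiv.Perm.sign σ = 1) :
    ∃ k ∈ ⁅hanoiGroup, hanoiGroup⁆, rootPerm k = σ := by
  let k := hanoiGen 0 * hanoiGen 1
  have hk : k * k ∈ ⁅hanoiGroup, hanoiGroup⁆ :=
    sq_mem_commutator (mul_mem (hanoiGen_mem 0) (hanoiGen_mem 1))
  have h1 : rootPerm (k * k) = finRotate 3 ∨ rootPerm (k * k) = (finRotate 3)⁻¹ := by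
    simp only [k, map_mul, rootPerm_hanoiGen]
    decide
  have h2 : ∀ τ : Equiv.Perm (Fin 3), τ = finRotate 3 ∨ τ = (finRotate 3)⁻¹ →
      ∀ σ : Equiv.Perm (Fin 3), Equiv.Perm.sign σ = 1 → σ = 1 ∨ σ = τ ∨ σ = τ⁻¹ := by
    decide
  rcases h2 _ h1 σ hσ with rfl | rfl | rfl
  · exact ⟨1, one_mem _, map_one _⟩
  · exact ⟨_, hk, rfl⟩
  · exact ⟨_, inv_mem hk, map_inv _ _⟩

/-- The elements of the commutator subgroup that fix the first level realize every pattern of signs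
on that level whose product is `1`. -/
theorem exists_mem_commutator_rootSign {ε : Fin 3 → ℤˣ} (hε : ∏ x, ε x = 1) :
    ∃ k ∈ ⁅hanoiGroup, hanoiGroup⁆, rootPerm k = 1 ∧ ∀ x, rootSign (k.sectionAt [x]) = ε x := by
  -- The square of the product of the three generators, in a suitable order, is even exactly below
  -- the peg of the middle generator.
  have key : ∀ i : Fin 3, ∃ k ∈ ⁅hanoiGroup, hanoiGroup⁆, rootPerm k = 1 ∧
      ∀ x, rootSign (k.sectionAt [x]) = if x = i then 1 else -1 := by
    intro i
    let k := hanoiGen (i + 1) * hanoiGen i * hanoiGen (i + 2)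
    refine ⟨k * k, sq_mem_commutator (mul_mem (mul_mem (hanoiGen_mem _) (hanoiGen_mem _))
      (hanoiGen_mem _)), ?_, fun x => ?_⟩
    · simp only [k, map_mul, rootPerm_hanoiGen]
      revert i
      decide
    · simp only [k, map_mul, rootPerm_hanoiGen, sectionAt_singleton_mul, sectionAt_hanoiGen,
        Pi.mulSingle_apply, apply_ite (rootSign (X := Fin 3)), rootSign_hanoiGen, map_one]
      revert i x
      decide
  have h1 : ∀ ε : Fin 3 → ℤˣ, ∏ x, ε x = 1 →
      (∀ x, ε x = 1) ∨ ∃ i, ∀ x, ε x = if x = i then 1 else -1 := by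
    decide
  rcases h1 ε hε with h | ⟨i, h⟩
  · exact ⟨1, one_mem _, map_one _, fun x => by rw [sectionAt_one, map_one, h]⟩
  · obtain ⟨k, h2, h3, h4⟩ := key i
    exact ⟨k, h2, h3, fun x => by rw [h4, h]⟩

/-- The commutator subgroup of the Hanoi group is dense in the even part of the parity group. -/
theorem exists_mem_commutator_app_eq (n : ℕ) {g : TreeAut (Fin 3)} (hg : g ∈ parityGroup (Fin 3))
    (h1 : rootSign g = 1) : ∃ k ∈ ⁅hanoiGroup, hanoiGroup⁆,
      ∀ v : List (Fin 3), v.length = n → k.app v = g.app v := by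
  induction n generalizing g with
  | zero =>
    refine ⟨1, one_mem _, fun v hv => ?_⟩
    rw [List.length_eq_zero_iff.1 hv, app_nil, app_nil]
  | succ n ih =>
    have hK : ⁅hanoiGroup, hanoiGroup⁆ ≤ parityGroup (Fin 3) :=
      (Subgroup.commutator_le_self _).trans hanoiGroup_le
    obtain ⟨k1, hk1, e1⟩ := exists_mem_commutator_rootPerm h1
    have hg1 : k1⁻¹ * g ∈ parityGroup (Fin 3) := mul_mem (inv_mem (hK hk1)) hg
    have hs : rootSign (k1⁻¹ * g) = 1 := by
      rw [rootSign_apply, map_mul, map_inv, e1, inv_mul_cancel, map_one]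
    obtain ⟨k2, hk2, e2, e3⟩ := exists_mem_commutator_rootSign
      ((mem_parityPattern.1 (mem_parityGroup_iff.1 hg1).1).symm.trans hs)
    have hg2 : k2⁻¹ * (k1⁻¹ * g) ∈ parityGroup (Fin 3) := mul_mem (inv_mem (hK hk2)) hg1
    have e4 : rootPerm (k2⁻¹ * (k1⁻¹ * g)) = 1 := by
      simp [e1, e2]
    have e5 : ∀ x, rootSign ((k2⁻¹ * (k1⁻¹ * g)).sectionAt [x]) = 1 := by
      intro x
      have e6 : rootPerm (k1⁻¹ * g) = 1 := by simp [e1]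
      rw [sectionAt_singleton_mul, e6, sectionAt_inv, app_singleton, map_inv, e2, map_mul,
        map_inv, inv_one, Equiv.Perm.one_apply, Equiv.Perm.one_apply, e3, inv_mul_cancel]
    choose f hf1 hf2 using fun x => ih (sectionAt_mem_parityGroup hg2 [x]) (e5 x)
    refine ⟨k1 * (k2 * base f), mul_mem hk1 (mul_mem hk2 (base_mem_commutator hf1)),
      fun v hv => ?_⟩
    rcases v with _ | ⟨x, v⟩
    · simp at hv
    have e7 : g = k1 * (k2 * base fun x => (k2⁻¹ * (k1⁻¹ * g)).sectionAt [x]) := by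
      rw [← eq_base e4]
      group
    conv_rhs => rw [e7]
    rw [app_mul, app_mul, app_mul k1, app_mul k2, base_apply, base_apply, wreath_app_cons,
      wreath_app_cons, hf2 x v (by simpa using hv)]

/-- The closure of the Hanoi group is the parity group. -/
theorem topologicalClosure_hanoiGroup : hanoiGroup.topologicalClosure = parityGroup (Fin 3) := by
  refine le_antisymm (hanoiGroup.topologicalClosure_minimal hanoiGroup_le isClosed_parityGroup)
    fun g hg => ?_
  refine mem_closure_iff_forall_level.2 fun n => ?_
  rcases Int.units_eq_one_or (rootSign g) with h | h
  · obtain ⟨k, hk, H⟩ := exists_mem_commutator_app_eq n hg h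
    exact ⟨k, Subgroup.commutator_le_self _ hk, H⟩
  · obtain ⟨k, hk, H⟩ := exists_mem_commutator_app_eq n
      (mul_mem (hanoiGen_mem_parityGroup 0) hg) (by rw [map_mul, h, rootSign_hanoiGen]; rfl)
    refine ⟨hanoiGen 0 * k, mul_mem (hanoiGen_mem 0) (Subgroup.commutator_le_self _ hk),
      fun v hv => ?_⟩
    rw [app_mul, H v hv, ← app_mul, ← mul_assoc, hanoiGen_mul_self, one_mul]

/-- The parity group is not of finite type of depth `1`: it realizes every permutation of the
first level, but it does not contain the rooted transpositions. -/
theorem not_isFiniteTypeOfDepth_one : ¬ IsFiniteTypeOfDepth (parityGroup (Fin 3)) 1 := by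
  rintro ⟨-, P, hP⟩
  let t : TreeAut (Fin 3) := rooted (Equiv.swap (2 + 1) (2 + 2))
  have h1 : t ∉ parityGroup (Fin 3) := by
    rw [rooted_mem_parityGroup]
    decide
  refine h1 ?_
  rw [hP]
  have h2 := hanoiGen_mem_parityGroup 2
  rw [hP] at h2
  rintro (_ | ⟨x, v⟩)
  · have h3 : trunc 1 t = trunc 1 (hanoiGen 2) := by
      refine Subtype.ext (RelIso.ext fun w => Subtype.ext ?_)
      obtain ⟨w, hw⟩ := w
      change t.app w = (hanoiGen 2).app w
      rcases w with _ | ⟨x, _ | ⟨y, w⟩⟩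
      · rfl
      · rw [app_singleton, app_singleton, rootPerm_rooted, rootPerm_hanoiGen]
      · simp at hw
    rw [sectionAt_nil, h3]
    simpa [sectionAt_nil] using h2 []
  · rw [sectionAt_cons, sectionAt_rooted, sectionAt_one, map_one]
    exact one_mem P

theorem isLeast_depth_parityGroup :
    IsLeast {D : ℕ | IsFiniteTypeOfDepth (parityGroup (Fin 3)) D} 2 := by
  refine ⟨⟨two_pos, _, parityGroup_eq_finiteTypeGroup⟩, fun D hD => ?_⟩
  by_contra h
  have h1 : D = 1 := by
    have := hD.1
    omega
  subst h1
  exact not_isFiniteTypeOfDepth_one hD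

end Hanoi

end TreeAut

/-! ### Commutators in the parity group -/

namespace TreeAut

section CommutatorWidth

/-- The products of two commutators of elements of the parity group. -/
def twoCommutators : Set (TreeAut (Fin 3)) :=
  {g | ∃ s ∈ parityGroup (Fin 3), ∃ t ∈ parityGroup (Fin 3), ∃ s' ∈ parityGroup (Fin 3),
    ∃ t' ∈ parityGroup (Fin 3), g = ⁅s, t⁆ * ⁅s', t'⁆}

/-- The elements of the parity group that act on the first level by an even permutation. -/
def evenParityGroup : Subgroup (TreeAut (Fin 3)) := parityGroup (Fin 3) ⊓ rootSign.ker

theorem mem_evenParityGroup {g : TreeAut (Fin 3)} :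
    g ∈ evenParityGroup ↔ g ∈ parityGroup (Fin 3) ∧ rootSign g = 1 := Iff.rfl

theorem twoCommutators_subset {g : TreeAut (Fin 3)} (hg : g ∈ twoCommutators) :
    g ∈ evenParityGroup := by
  obtain ⟨s, hs, t, ht, s', hs', t', ht', rfl⟩ := hg
  refine ⟨mul_mem ?_ ?_, ?_⟩
  · exact Subgroup.commutator_le_self _ (Subgroup.commutator_mem_commutator hs ht)
  · exact Subgroup.commutator_le_self _ (Subgroup.commutator_mem_commutator hs' ht')
  · change rootSign _ = 1
    rw [map_mul, map_commutatorElement, map_commutatorElement,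
      commutatorElement_eq_one_iff_commute.2 (Commute.all _ _),
      commutatorElement_eq_one_iff_commute.2 (Commute.all _ _), one_mul]

/-- The products of two commutators form a closed set, because the group is compact. -/
theorem isClosed_twoCommutators : IsClosed twoCommutators := by
  have hG : IsCompact (parityGroup (Fin 3) : Set (TreeAut (Fin 3))) :=
    isClosed_parityGroup.isCompact
  have h1 := ((hG.prod hG).prod (hG.prod hG)).image
    (f := fun p : (TreeAut (Fin 3) × TreeAut (Fin 3)) × (TreeAut (Fin 3) × TreeAut (Fin 3)) =>
      ⁅p.1.1, p.1.2⁆ * ⁅p.2.1, p.2.2⁆) (by simp only [commutatorElement_def]; fun_prop)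
  convert h1.isClosed using 1
  ext g
  constructor
  · rintro ⟨s, hs, t, ht, s', hs', t', ht', rfl⟩
    exact ⟨((s, t), (s', t')), ⟨⟨hs, ht⟩, ⟨hs', ht'⟩⟩, rfl⟩
  · rintro ⟨⟨⟨s, t⟩, ⟨s', t'⟩⟩, ⟨⟨hs, ht⟩, ⟨hs', ht'⟩⟩, rfl⟩
    exact ⟨s, hs, t, ht, s', hs', t', ht', rfl⟩

/-- Two commuting elements of the parity group with prescribed signs at the root. -/
theorem exists_commute_rootSign (ε δ : ℤˣ) :
    ∃ z ∈ parityGroup (Fin 3), ∃ y ∈ parityGroup (Fin 3),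
      rootSign z = ε ∧ rootSign y = δ ∧ Commute z y := by
  have h0 := hanoiGen_mem_parityGroup 0
  rcases Int.units_eq_one_or ε with rfl | rfl <;> rcases Int.units_eq_one_or δ with rfl | rfl
  · exact ⟨1, one_mem _, 1, one_mem _, map_one _, map_one _, Commute.one_left _⟩
  · exact ⟨1, one_mem _, _, h0, map_one _, rootSign_hanoiGen 0, Commute.one_left _⟩
  · exact ⟨_, h0, 1, one_mem _, rootSign_hanoiGen 0, map_one _, Commute.one_right _⟩
  · exact ⟨_, h0, _, h0, rootSign_hanoiGen 0, rootSign_hanoiGen 0, Commute.refl _⟩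

section ThreeLetters

variable {i j k : Fin 3}

theorem eq_or_eq_or_eq_of_ne (hij : i ≠ j) (hik : i ≠ k) (hjk : j ≠ k) (x : Fin 3) :
    x = i ∨ x = j ∨ x = k := by
  revert i j k x
  decide

theorem prod_eq_of_ne {M : Type*} [CommMonoid M] (hij : i ≠ j) (hik : i ≠ k) (hjk : j ≠ k)
    (F : Fin 3 → M) : ∏ x, F x = F i * F j * F k := by
  have h : (Finset.univ : Finset (Fin 3)) = {i, j, k} := by
    revert i j k
    decide
  rw [h, Finset.prod_insert (by simp [hij, hik]), Finset.prod_pair hjk, mul_assoc]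

theorem exists_values_of_ne {M : Type*} (hij : i ≠ j) (hik : i ≠ k) (hjk : j ≠ k) (a b c : M) :
    ∃ F : Fin 3 → M, F i = a ∧ F j = b ∧ F k = c :=
  ⟨fun x => if x = i then a else if x = j then b else c, by simp, by simp [hij.symm],
    by simp [hik.symm, hjk.symm]⟩

theorem threeCycle_properties (hij : i ≠ j) (hik : i ≠ k) (hjk : j ≠ k)
    {r : Equiv.Perm (Fin 3)} (hri : r i = j) (hrj : r j = k) (hrk : r k = i) :
    Equiv.Perm.sign r = 1 ∧ Equiv.swap i j * r⁻¹ * (Equiv.swap i j)⁻¹ = r ∧ r * r = r⁻¹ := by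
  revert i j k r
  decide

/-- Solving `f(x) = d(x) d(r⁻¹ x)⁻¹` along the three-cycle `r = (i j k)`: it suffices that the
product of the values of `f` around the cycle is trivial, and the total sign of `d` may be
prescribed. -/
theorem exists_cyclic_quotient (hij : i ≠ j) (hik : i ≠ k) (hjk : j ≠ k)
    {r : Equiv.Perm (Fin 3)} (hri : r i = j) (hrj : r j = k) (hrk : r k = i)
    {f : Fin 3 → TreeAut (Fin 3)} (hf : ∀ x, f x ∈ parityGroup (Fin 3))
    (hprod : f i * f k * f j = 1) (ε : ℤˣ) :
    ∃ d : Fin 3 → TreeAut (Fin 3), (∀ x, d x ∈ parityGroup (Fin 3)) ∧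
      ∏ x, rootSign (d x) = ε ∧ f = fun x => d x * (d (r⁻¹ x))⁻¹ := by
  obtain ⟨z, hz, -, -, hz1, -, -⟩ := exists_commute_rootSign (ε * rootSign (f k)) 1
  obtain ⟨d, hdi, hdj, hdk⟩ := exists_values_of_ne hij hik hjk z (f j * z) (f k * (f j * z))
  have hri' : r⁻¹ j = i := by rw [Equiv.Perm.inv_eq_iff_eq, hri]
  have hrj' : r⁻¹ k = j := by rw [Equiv.Perm.inv_eq_iff_eq, hrj]
  have hrk' : r⁻¹ i = k := by rw [Equiv.Perm.inv_eq_iff_eq, hrk]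
  refine ⟨d, fun x => ?_, ?_, funext fun x => ?_⟩
  · rcases eq_or_eq_or_eq_of_ne hij hik hjk x with rfl | rfl | rfl
    · rwa [hdi]
    · rw [hdj]
      exact mul_mem (hf _) hz
    · rw [hdk]
      exact mul_mem (hf _) (mul_mem (hf _) hz)
  · rw [prod_eq_of_ne hij hik hjk, hdi, hdj, hdk]
    simp only [map_mul, hz1]
    rcases Int.units_eq_one_or ε with rfl | rfl <;>
      rcases Int.units_eq_one_or (rootSign (f j)) with h | h <;>
      rcases Int.units_eq_one_or (rootSign (f k)) with h' | h' <;> simp [h, h']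
  · rcases eq_or_eq_or_eq_of_ne hij hik hjk x with rfl | rfl | rfl
    · rw [hrk', hdi, hdk, mul_inv_rev, mul_inv_rev, mul_assoc z⁻¹, mul_inv_cancel_left,
        ← mul_inv_rev, eq_inv_iff_mul_eq_one, ← mul_assoc, hprod]
    · rw [hri', hdi, hdj, mul_inv_cancel_right]
    · rw [hrj', hdj, hdk, mul_inv_cancel_right]

/-- If the product of the sections `f x` around the three-cycle `r` is a product of two
commutators, then so are `base f` and `base f * rooted r⁻¹`. The first commutator places the two
commutators below two different vertices; the signs of its entries are corrected below the third
vertex, by a pair of commuting elements. What remains is a commutator with a lift of `r`. -/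
theorem base_mem_twoCommutators (hij : i ≠ j) (hik : i ≠ k) (hjk : j ≠ k)
    {r : Equiv.Perm (Fin 3)} (hri : r i = j) (hrj : r j = k) (hrk : r k = i)
    {f : Fin 3 → TreeAut (Fin 3)} (hf : ∀ x, f x ∈ parityGroup (Fin 3))
    (hprod : f i * f k * f j ∈ twoCommutators) :
    base f ∈ twoCommutators ∧ base f * rooted r⁻¹ ∈ twoCommutators := by
  obtain ⟨s', hs', t', ht', s, hs, t, ht, hst⟩ := hprod
  have hw : f i * f k ∈ parityGroup (Fin 3) := mul_mem (hf i) (hf k)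
  obtain ⟨z, hz, y, hy, hz1, hy1, hzy⟩ :=
    exists_commute_rootSign (rootSign s * rootSign s') (rootSign t * rootSign t')
  obtain ⟨p, hpi, hpj, hpk⟩ := exists_values_of_ne hij hik hjk s
    ((f i * f k)⁻¹ * s' * (f i * f k)) z
  obtain ⟨q, hqi, hqj, hqk⟩ := exists_values_of_ne hij hik hjk t
    ((f i * f k)⁻¹ * t' * (f i * f k)) y
  have hp : base p ∈ parityGroup (Fin 3) := by
    refine base_mem_parityGroup.2 ⟨?_, fun x => ?_⟩
    · rw [prod_eq_of_ne hij hik hjk, hpi, hpj, hpk, hz1]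
      simp only [map_mul, map_inv]
      rw [inv_mul_cancel_comm, Int.units_mul_self]
    · rcases eq_or_eq_or_eq_of_ne hij hik hjk x with rfl | rfl | rfl
      · rwa [hpi]
      · rw [hpj]
        exact mul_mem (mul_mem (inv_mem hw) hs') hw
      · rwa [hpk]
  have hq : base q ∈ parityGroup (Fin 3) := by
    refine base_mem_parityGroup.2 ⟨?_, fun x => ?_⟩
    · rw [prod_eq_of_ne hij hik hjk, hqi, hqj, hqk, hy1]
      simp only [map_mul, map_inv]
      rw [inv_mul_cancel_comm, Int.units_mul_self]
    · rcases eq_or_eq_or_eq_of_ne hij hik hjk x with rfl | rfl | rfl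
      · rwa [hqi]
      · rw [hqj]
        exact mul_mem (mul_mem (inv_mem hw) ht') hw
      · rwa [hqk]
  -- The part of `f` that is left after splitting off `⁅p, q⁆`.
  obtain ⟨f', hf'⟩ : ∃ f' : Fin 3 → TreeAut (Fin 3), f' = ⁅p, q⁆⁻¹ * f := ⟨_, rfl⟩
  have hff' : base f = ⁅base p, base q⁆ * base f' := by
    rw [← map_commutatorElement, ← map_mul, hf', mul_inv_cancel_left]
  have hf'G : ∀ x, f' x ∈ parityGroup (Fin 3) := by
    intro x
    rw [hf']
    refine mul_mem (inv_mem (Subgroup.commutator_le_self _ (Subgroup.commutator_mem_commutator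
      ((base_mem_parityGroup.1 hp).2 x) ((base_mem_parityGroup.1 hq).2 x)))) (hf x)
  have hprod' : f' i * f' k * f' j = 1 := by
    have h1 : f' i = ⁅s, t⁆⁻¹ * f i := by
      rw [hf', ← hpi, ← hqi]
      rfl
    have h2 : f' k = f k := by
      have h3 : f' k = ⁅z, y⁆⁻¹ * f k := by
        rw [hf', ← hpk, ← hqk]
        rfl
      rw [h3, hzy.commutator_eq, inv_one, one_mul]
    have h4 : f' j = ((f i * f k)⁻¹ * ⁅s', t'⁆ * (f i * f k))⁻¹ * f j := by
      have h5 : f' j = ⁅p j, q j⁆⁻¹ * f j := by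
        rw [hf']
        rfl
      rw [h5, hpj, hqj]
      simp only [commutatorElement_def]
      group
    rw [h1, h2, h4]
    have h6 : ⁅s, t⁆ = ⁅s', t'⁆⁻¹ * (f i * f k * f j) := by
      rw [hst, inv_mul_cancel_left]
    rw [h6]
    group
  have conj : ∀ d : Fin 3 → TreeAut (Fin 3),
      base d * rooted r * (base d)⁻¹ * (rooted r)⁻¹ = base fun x => d x * (d (r⁻¹ x))⁻¹ := by
    intro d
    rw [mul_assoc (base d), ← map_inv, rooted_mul_base, ← mul_assoc, mul_inv_cancel_right,
      ← map_mul]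
    rfl
  obtain ⟨hr1, hr2, hr3⟩ := threeCycle_properties hij hik hjk hri hrj hrk
  constructor
  · obtain ⟨d, hd, hd1, hd2⟩ := exists_cyclic_quotient hij hik hjk hri hrj hrk hf'G hprod' 1
    refine ⟨_, hp, _, hq, base d, base_mem_parityGroup.2 ⟨hd1, hd⟩, rooted r,
      rooted_mem_parityGroup.2 hr1, ?_⟩
    rw [hff', commutatorElement_def (base d), conj, ← hd2]
  · -- A lift of a transposition conjugates the lift of `r⁻¹` to that of `r`.
    obtain ⟨d, hd, hd1, hd2⟩ := exists_cyclic_quotient hij hik hjk hri hrj hrk hf'G hprod' (-1)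
    refine ⟨_, hp, _, hq, base d * rooted (Equiv.swap i j), ?_, rooted r⁻¹,
      rooted_mem_parityGroup.2 (by rw [map_inv, hr1, inv_one]), ?_⟩
    · rw [base_apply, rooted_apply, wreath_mul, wreath_mem_parityGroup]
      refine ⟨?_, fun x => by simpa using hd _⟩
      simp only [one_mul, Pi.one_apply, mul_one]
      rw [Equiv.prod_comp (Equiv.swap i j) fun x => rootSign (d x), hd1,
        Equiv.Perm.sign_swap hij]
    · have h7 : ⁅base d * rooted (Equiv.swap i j), rooted r⁻¹⁆ =
          base d * rooted r * (base d)⁻¹ * (rooted r)⁻¹ * rooted r⁻¹ := by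
        have h8 : (rooted r)⁻¹ * rooted r⁻¹ = (rooted r⁻¹)⁻¹ := by
          rw [← map_inv, ← map_inv, ← map_mul, ← mul_inv_rev, hr3]
        have h9 : rooted (Equiv.swap i j) * rooted r⁻¹ * (rooted (Equiv.swap i j))⁻¹ =
            rooted r := by
          rw [← map_inv, ← map_mul, ← map_mul, hr2]
        rw [mul_assoc _ (rooted r)⁻¹, h8]
        conv_rhs => rw [← h9]
        simp only [commutatorElement_def]
        group
      rw [h7, conj, ← hd2, hff', mul_assoc]

end ThreeLetters

/-- Modulo each level stabilizer, every even element of the parity group is a product of two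
commutators. -/
theorem exists_twoCommutators_app_eq (n : ℕ) {g : TreeAut (Fin 3)} (hg : g ∈ evenParityGroup) :
    ∃ h ∈ twoCommutators, ∀ v : List (Fin 3), v.length = n → h.app v = g.app v := by
  induction n generalizing g with
  | zero =>
    refine ⟨1, ⟨1, one_mem _, 1, one_mem _, 1, one_mem _, 1, one_mem _, by simp⟩, fun v hv => ?_⟩
    rw [List.length_eq_zero_iff.1 hv, app_nil, app_nil]
  | succ n ih =>
    obtain ⟨σ, hσ⟩ : ∃ σ, σ = rootPerm g := ⟨_, rfl⟩
    obtain ⟨f, hf⟩ : ∃ f : Fin 3 → TreeAut (Fin 3), f = fun x => g.sectionAt [σ⁻¹ x] := ⟨_, rfl⟩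
    have hgf : g = base f * rooted σ := by
      rw [hf, hσ]
      exact eq_base_mul_rooted g
    have hfG : ∀ x, f x ∈ parityGroup (Fin 3) := fun x => by
      rw [hf]
      exact sectionAt_mem_parityGroup hg.1 _
    have hsign : ∏ x, rootSign (f x) = 1 := by
      have h1 := mem_parityPattern.1 (mem_parityGroup_iff.1 hg.1).1
      rw [(mem_evenParityGroup.1 hg).2] at h1
      rw [hf, Equiv.prod_comp σ⁻¹ fun x => rootSign (g.sectionAt [x]), ← h1]
    have hcase : ∃ (r : Equiv.Perm (Fin 3)) (i j k : Fin 3), i ≠ j ∧ i ≠ k ∧ j ≠ k ∧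
        r i = j ∧ r j = k ∧ r k = i ∧ (σ = 1 ∨ σ = r⁻¹) := by
      have h1 : Equiv.Perm.sign σ = 1 := by
        rw [hσ]
        exact (mem_evenParityGroup.1 hg).2
      clear hσ hf hgf
      revert σ
      decide
    obtain ⟨r, i, j, k, hij, hik, hjk, hri, hrj, hrk, hrσ⟩ := hcase
    obtain ⟨c, hc, hc2⟩ := ih (g := f i * f k * f j)
      ⟨mul_mem (mul_mem (hfG i) (hfG k)) (hfG j), by
        rw [prod_eq_of_ne hij hik hjk] at hsign
        change rootSign (f i * f k * f j) = 1
        rw [map_mul, map_mul, mul_right_comm, hsign]⟩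
    -- Change the section at `i` so that the product around the cycle becomes `c`.
    obtain ⟨f', hi, hj, hk⟩ := exists_values_of_ne hij hik hjk (c * (f k * f j)⁻¹) (f j) (f k)
    have hf'G : ∀ x, f' x ∈ parityGroup (Fin 3) := by
      intro x
      rcases eq_or_eq_or_eq_of_ne hij hik hjk x with rfl | rfl | rfl
      · rw [hi]
        exact mul_mem (twoCommutators_subset hc).1 (inv_mem (mul_mem (hfG _) (hfG _)))
      · rw [hj]
        exact hfG _
      · rw [hk]
        exact hfG _
    have hff' : ∀ x, ∀ v : List (Fin 3), v.length = n → (f' x).app v = (f x).app v := by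
      intro x v hv
      rcases eq_or_eq_or_eq_of_ne hij hik hjk x with rfl | rfl | rfl
      · rw [hi, app_mul, hc2 _ (by rw [length_app, hv]), ← app_mul, mul_assoc (f x),
          mul_inv_cancel_right]
      · rw [hj]
      · rw [hk]
    have h1 := base_mem_twoCommutators hij hik hjk hri hrj hrk hf'G
      (by rw [hi, hj, hk, mul_assoc, inv_mul_cancel_right]; exact hc)
    refine ⟨base f' * rooted σ, ?_, fun v hv => ?_⟩
    · rcases hrσ with rfl | rfl
      · rw [map_one, mul_one]
        exact h1.1
      · exact h1.2
    · rcases v with _ | ⟨x, v⟩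
      · simp at hv
      · rw [hgf, app_mul, app_mul, rooted_apply, wreath_app_cons, base_apply, base_apply,
          wreath_app_cons, wreath_app_cons, Pi.one_apply, app_one,
          hff' _ v (by simpa using hv)]

/-- Every even element of the parity group is a product of two commutators. -/
theorem evenParityGroup_subset_twoCommutators {g : TreeAut (Fin 3)} (hg : g ∈ evenParityGroup) :
    g ∈ twoCommutators := by
  rw [← isClosed_twoCommutators.closure_eq, mem_closure_iff_forall_level]
  exact fun n => exists_twoCommutators_app_eq n hg

/-- The abstract commutator subgroup of the even part of the parity group contains the copies of
this even part below the vertices of the first level. -/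
theorem base_mulSingle_mem_commutator_evenParityGroup (x : Fin 3) {g : TreeAut (Fin 3)}
    (hg : g ∈ evenParityGroup) :
    base (Pi.mulSingle x g) ∈ ⁅evenParityGroup, evenParityGroup⁆ := by
  have double : ∀ s ∈ parityGroup (Fin 3), ∀ x y : Fin 3, x ≠ y →
      base (Pi.mulSingle x s * Pi.mulSingle y s) ∈ evenParityGroup := by
    intro s hs x y hxy
    refine ⟨base_mem_parityGroup.2 ⟨?_, fun w => ?_⟩, rootSign_base _⟩
    · simp only [Pi.mul_apply, map_mul, Finset.prod_mul_distrib]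
      rw [Finset.prod_eq_single x (by intro w _ hw; simp [Pi.mulSingle_eq_of_ne hw]) (by simp),
        Finset.prod_eq_single y (by intro w _ hw; simp [Pi.mulSingle_eq_of_ne hw]) (by simp),
        Pi.mulSingle_eq_same, Pi.mulSingle_eq_same, Int.units_mul_self]
    · refine mul_mem ?_ ?_ <;> rw [Pi.mulSingle_apply] <;> split_ifs <;>
        first | exact hs | exact one_mem _
  have single : ∀ s ∈ parityGroup (Fin 3), ∀ t ∈ parityGroup (Fin 3),
      base (Pi.mulSingle x ⁅s, t⁆) ∈ ⁅evenParityGroup, evenParityGroup⁆ := by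
    intro s hs t ht
    -- The supports of the two factors only meet below `x`.
    have h1 : (Pi.mulSingle x ⁅s, t⁆ : Fin 3 → TreeAut (Fin 3)) =
        ⁅Pi.mulSingle x s * Pi.mulSingle (M := fun _ => TreeAut (Fin 3)) (x + 1) s,
          Pi.mulSingle x t * Pi.mulSingle (M := fun _ => TreeAut (Fin 3)) (x + 2) t⁆ := by
      ext1 y
      simp only [commutatorElement_def, Pi.mul_apply, Pi.inv_apply, Pi.mulSingle_apply]
      fin_cases x <;> fin_cases y <;> simp
    rw [h1, map_commutatorElement]
    exact Subgroup.commutator_mem_commutator (double s hs x _ (by simp))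
      (double t ht x _ (by simp))
  obtain ⟨s, hs, t, ht, s', hs', t', ht', rfl⟩ := evenParityGroup_subset_twoCommutators hg
  rw [Pi.mulSingle_mul, map_mul]
  exact mul_mem (single s hs t ht) (single s' hs' t' ht')

end CommutatorWidth

end TreeAut

/-! ### Normal subgroups of the parity group -/

namespace TreeAut

section NormalSubgroups

/-- The even part of the parity group acts transitively on each level. -/
theorem exists_evenParityGroup_app_eq {u v : List (Fin 3)} (h : u.length = v.length) :
    ∃ g ∈ evenParityGroup, g.app u = v := by
  induction u generalizing v with
  | nil =>
    rw [List.length_nil, eq_comm, List.length_eq_zero_iff] at h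
    exact ⟨1, one_mem _, by rw [h, app_nil]⟩
  | cons x u ih =>
    rcases v with _ | ⟨y, v⟩
    · simp at h
    · obtain ⟨g, hg, hgu⟩ := ih (by simpa using h)
      have h1 : ∀ x y : Fin 3, ∃ σ : Equiv.Perm (Fin 3), Equiv.Perm.sign σ = 1 ∧ σ x = y := by
        decide
      obtain ⟨σ, hσ, hσx⟩ := h1 x y
      refine ⟨atVertex [y] g * rooted σ, mul_mem (atVertex_mem_parityGroup hg.1 hg.2 [y])
        ⟨rooted_mem_parityGroup.2 hσ, ?_⟩, ?_⟩
      · change rootSign _ = 1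
        rw [rootSign_apply, rootPerm_rooted, hσ]
      · rw [app_mul, rooted_apply, wreath_app_cons, hσx, Pi.one_apply, app_one, atVertex_singleton,
          base_apply, wreath_app_cons, Pi.mulSingle_eq_same, hgu]
        rfl

/-- Elements fixing level `m` are products of elements supported below the vertices of that
level. -/
theorem mem_of_atVertex_mem {M : Subgroup (TreeAut (Fin 3))} (m : ℕ) {k : ℕ}
    (hM : ∀ w : List (Fin 3), w.length = m → ∀ g ∈ parityGroup (Fin 3), g ∈ levelStab (Fin 3) k →
      atVertex w g ∈ M) {g : TreeAut (Fin 3)} (hg : g ∈ parityGroup (Fin 3))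
    (hgs : g ∈ levelStab (Fin 3) (k + m)) : g ∈ M := by
  induction m generalizing k with
  | zero => exact hM [] rfl g hg hgs
  | succ m ih =>
    refine ih (k := k + 1) (fun w hw g hg hgs => ?_) (by rwa [add_assoc, add_comm 1 m])
    have h1 : rootPerm g = 1 :=
      rootPerm_eq (n := k + 1) (h := 1) (by omega) hgs
    have h2 : ∀ x, g.sectionAt [x] ∈ levelStab (Fin 3) k := by
      intro x v hv
      have h3 := hgs (x :: v) (by simp [hv])
      rw [app_cons] at h3
      exact (List.cons.inj h3).2
    have h4 : ∀ x, atVertex w (base (Pi.mulSingle x (g.sectionAt [x]))) ∈ M := by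
      intro x
      rw [← atVertex_singleton, ← atVertex_append]
      exact hM _ (by simp [hw]) _ (sectionAt_mem_parityGroup hg [x]) (h2 x)
    have h5 : (fun x => g.sectionAt [x]) = Pi.mulSingle 0 (g.sectionAt [0]) *
        Pi.mulSingle 1 (g.sectionAt [1]) * Pi.mulSingle 2 (g.sectionAt [2]) := by
      ext1 x
      fin_cases x <;> simp
    rw [eq_base h1, h5, map_mul, map_mul, map_mul, map_mul]
    exact mul_mem (mul_mem (h4 0) (h4 1)) (h4 2)

/-- A nontrivial subgroup normalized by the parity group contains a congruence subgroup. If an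
element `g` of it moves the vertex `v`, then the double commutators of `g` with elements supported
below `v` fill the commutator subgroup of the copy of the even part below `v`. -/
theorem exists_levelStab_le_of_normalized {M : Subgroup (TreeAut (Fin 3))} (hM : M ≠ ⊥)
    (hconj : ∀ h ∈ parityGroup (Fin 3), ∀ g ∈ M, h * g * h⁻¹ ∈ M) :
    ∃ n, ∀ g ∈ parityGroup (Fin 3), g ∈ levelStab (Fin 3) n → g ∈ M := by
  obtain ⟨g, hgM, hg1⟩ := M.bot_or_exists_ne_one.resolve_left hM
  obtain ⟨v, hv⟩ : ∃ v, g.app v ≠ v := by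
    by_contra! H
    exact hg1 (ext H)
  have hEG : ∀ e ∈ evenParityGroup, ∀ w, atVertex w e ∈ parityGroup (Fin 3) := fun e he w =>
    (atVertex_mem_parityGroup he.1 he.2 w).1
  have comm : ∀ e ∈ evenParityGroup, ∀ f ∈ evenParityGroup, atVertex v ⁅e, f⁆ ∈ M := by
    intro e he f hf
    obtain ⟨b, hb⟩ : ∃ b, b = g * atVertex v e⁻¹ * g⁻¹ := ⟨_, rfl⟩
    have hb' := hb
    rw [conj_atVertex] at hb'
    have hbe : Commute b (atVertex v e) := by
      rw [hb']
      exact commute_atVertex (g.length_app v) hv _ _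
    have hbf : Commute b (atVertex v f) := by
      rw [hb']
      exact commute_atVertex (g.length_app v) hv _ _
    have h1 : b * atVertex v e ∈ M := by
      have h2 : b * atVertex v e = g * (atVertex v e⁻¹ * g⁻¹ * (atVertex v e⁻¹)⁻¹) := by
        rw [hb, map_inv, inv_inv]
        group
      rw [h2]
      exact mul_mem hgM (hconj _ (hEG _ (inv_mem he) v) _ (inv_mem hgM))
    have h3 : atVertex v ⁅e, f⁆ = (b * atVertex v e) *
        (atVertex v f * (b * atVertex v e)⁻¹ * (atVertex v f)⁻¹) := by
      have h4 : Commute b (atVertex v ⁅e, f⁆) := by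
        rw [map_commutatorElement, commutatorElement_def]
        exact ((hbe.mul_right hbf).mul_right hbe.inv_right).mul_right hbf.inv_right
      have h5 : (b * atVertex v e) * (atVertex v f * (b * atVertex v e)⁻¹ * (atVertex v f)⁻¹) =
          b * atVertex v ⁅e, f⁆ * (atVertex v f * b⁻¹ * (atVertex v f)⁻¹) := by
        rw [map_commutatorElement, commutatorElement_def]
        group
      rw [h5, h4.eq, hbf.symm.inv_right.eq]
      group
    rw [h3]
    exact mul_mem h1 (hconj _ (hEG _ hf v) _ (inv_mem h1))
  have h6 : ⁅evenParityGroup, evenParityGroup⁆ ≤ M.comap (atVertex v) :=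
    Subgroup.commutator_le.2 comm
  have below : ∀ e ∈ evenParityGroup, atVertex (v ++ [0]) e ∈ M := by
    intro e he
    rw [atVertex_append, atVertex_singleton]
    exact h6 (base_mulSingle_mem_commutator_evenParityGroup 0 he)
  refine ⟨1 + (v.length + 1), fun k hk hks => mem_of_atVertex_mem (v.length + 1) ?_ hk hks⟩
  intro w hw e he hes
  obtain ⟨h, hh, hhw⟩ := exists_evenParityGroup_app_eq (u := v ++ [0]) (v := w) (by simp [hw])
  have hs := sectionAt_mem_parityGroup hh.1 (v ++ [0])
  have h7 := conj_atVertex h (v ++ [0])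
    ((h.sectionAt (v ++ [0]))⁻¹ * e * h.sectionAt (v ++ [0]))
  have h8 : h.sectionAt (v ++ [0]) * ((h.sectionAt (v ++ [0]))⁻¹ * e * h.sectionAt (v ++ [0])) *
      (h.sectionAt (v ++ [0]))⁻¹ = e := by
    group
  rw [h8, hhw] at h7
  rw [← h7]
  refine hconj _ hh.1 _ (below _ (mem_evenParityGroup.2
    ⟨mul_mem (mul_mem (inv_mem hs) he) hs, ?_⟩))
  rw [map_mul, map_mul, map_inv, inv_mul_cancel_comm, rootSign_eq le_rfl (h := 1) hes, map_one]

/-- Every nontrivial normal subgroup of the parity group is open. -/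
theorem isOpen_of_normal {N : Subgroup ↥(parityGroup (Fin 3))} (hN : N.Normal) (h1 : N ≠ ⊥) :
    IsOpen (N : Set ↥(parityGroup (Fin 3))) := by
  obtain ⟨n, hn⟩ := exists_levelStab_le_of_normalized
    (M := N.map (parityGroup (Fin 3)).subtype)
    (by rwa [Ne, Subgroup.map_eq_bot_iff_of_injective _ Subtype.val_injective]) (by
      rintro h hh _ ⟨g, hg, rfl⟩
      exact ⟨⟨h, hh⟩ * g * ⟨h, hh⟩⁻¹, hN.conj_mem g hg ⟨h, hh⟩, rfl⟩)
  have h2 : (levelStab (Fin 3) n).subgroupOf (parityGroup (Fin 3)) ≤ N := by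
    intro g hg
    obtain ⟨k, hk, hkg⟩ := hn g.1 g.2 hg
    rwa [← Subtype.val_injective hkg]
  exact Subgroup.isOpen_mono h2 ((isOpen_levelStab n).preimage continuous_subtype_val)

theorem isTopJustInfinite_parityGroup (h : Infinite ↥(parityGroup (Fin 3))) :
    IsTopJustInfinite ↥(parityGroup (Fin 3)) := by
  refine ⟨h, fun N hN _ h1 => ?_⟩
  have h2 : CompactSpace ↥(parityGroup (Fin 3)) :=
    isCompact_iff_compactSpace.1 isClosed_parityGroup.isCompact
  have := N.quotient_finite_of_isOpen (isOpen_of_normal hN h1)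
  exact Subgroup.finiteIndex_of_finite_quotient

theorem isStronglyComplete_parityGroup (h : Infinite ↥(parityGroup (Fin 3))) :
    IsStronglyComplete ↥(parityGroup (Fin 3)) := by
  intro K hK
  refine Subgroup.isOpen_mono K.normalCore_le (isOpen_of_normal K.normalCore_normal fun h1 => ?_)
  have h2 : K.normalCore.FiniteIndex := inferInstance
  rw [h1] at h2
  have h3 := h2.index_ne_zero
  rw [Subgroup.index_bot, Nat.card_eq_zero_of_infinite] at h3
  exact h3 rfl

end NormalSubgroups

end TreeAut

/-! ### An infinite dihedral quotient of the Hanoi group -/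

namespace TreeAut

section Dihedral

/-- The automorphism represented by a word in the generators; the leftmost letter acts first. -/
def wordEval : List (Fin 3) → TreeAut (Fin 3)
  | [] => 1
  | x :: u => wordEval u * hanoiGen x

/-- The position to which the letter `v` is moved by a word in the generators. -/
def wordPos : Fin 3 → List (Fin 3) → Fin 3
  | v, [] => v
  | v, x :: u => wordPos (Equiv.swap (x + 1) (x + 2) v) u

/-- The word representing the section at the letter `v`: the letters that meet their own peg while
`v` is moved along. -/
def wordSection : Fin 3 → List (Fin 3) → List (Fin 3)
  | _, [] => []
  | v, x :: u => if v = x then x :: wordSection v u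
      else wordSection (Equiv.swap (x + 1) (x + 2) v) u

/-- The letters `0` and `1` are sent to reflections of `ℤ` and `2` to the identity. This is the
linear part of the image of a word. -/
def dihedralSign : List (Fin 3) → ℤ
  | [] => 1
  | x :: u => ![-1, -1, 1] x * dihedralSign u

/-- The translation part of the image of a word in the infinite dihedral group, where the letters
`0` and `1` act by `t ↦ 1 - t` and `t ↦ -1 - t`, and `2` acts trivially. -/
def dihedralShift : List (Fin 3) → ℤ
  | [] => 0
  | x :: u => ![1, -1, 0] x + ![-1, -1, 1] x * dihedralShift u

theorem wordEval_app_cons (u : List (Fin 3)) (v : Fin 3) (w : List (Fin 3)) :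
    (wordEval u).app (v :: w) = wordPos v u :: (wordEval (wordSection v u)).app w := by
  induction u generalizing v w with
  | nil => rfl
  | cons x u ih =>
    rw [wordEval, app_mul, app_cons, rootPerm_hanoiGen, ih, wordPos, wordSection]
    by_cases h : v = x
    · subst h
      rw [if_pos rfl, sectionAt_hanoiGen_self, wordEval, app_mul,
        Equiv.swap_apply_of_ne_of_ne (by simp) (by simp)]
    · rw [if_neg h, sectionAt_hanoiGen_of_ne h, app_one]

theorem wordEval_append (u v : List (Fin 3)) : wordEval (u ++ v) = wordEval v * wordEval u := by
  induction u with
  | nil => simp [wordEval]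
  | cons x u ih => rw [List.cons_append, wordEval, ih, wordEval, mul_assoc]

theorem wordEval_reverse (u : List (Fin 3)) : wordEval u.reverse = (wordEval u)⁻¹ := by
  induction u with
  | nil => simp [wordEval]
  | cons x u ih =>
    simp [wordEval_append, ih, wordEval, hanoiGen_inv]

theorem wordEval_mem (u : List (Fin 3)) : wordEval u ∈ hanoiGroup := by
  induction u with
  | nil => exact one_mem _
  | cons x u ih => exact mul_mem ih (hanoiGen_mem x)

theorem exists_wordEval_eq {g : TreeAut (Fin 3)} (hg : g ∈ hanoiGroup) : ∃ u, wordEval u = g := by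
  rw [hanoiGroup_eq] at hg
  induction hg using Subgroup.closure_induction with
  | mem g hg =>
    obtain ⟨i, rfl⟩ := hg
    exact ⟨[i], by simp [wordEval]⟩
  | one => exact ⟨[], rfl⟩
  | mul g h _ _ ihg ihh =>
    obtain ⟨u, rfl⟩ := ihg
    obtain ⟨v, rfl⟩ := ihh
    exact ⟨v ++ u, wordEval_append v u⟩
  | inv g _ ih =>
    obtain ⟨u, rfl⟩ := ih
    exact ⟨u.reverse, wordEval_reverse u⟩

theorem dihedralSign_append (u v : List (Fin 3)) :
    dihedralSign (u ++ v) = dihedralSign u * dihedralSign v := by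
  induction u with
  | nil => simp [dihedralSign]
  | cons x u ih => rw [List.cons_append, dihedralSign, dihedralSign, ih, mul_assoc]

theorem dihedralShift_append (u v : List (Fin 3)) :
    dihedralShift (u ++ v) = dihedralShift u + dihedralSign u * dihedralShift v := by
  induction u with
  | nil => simp [dihedralShift, dihedralSign]
  | cons x u ih =>
    rw [List.cons_append, dihedralShift, dihedralShift, ih, dihedralSign]
    ring

theorem dihedralSign_mul_self (u : List (Fin 3)) : dihedralSign u * dihedralSign u = 1 := by
  induction u with
  | nil => rfl
  | cons x u ih =>
    rw [dihedralSign, mul_mul_mul_comm, ih]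
    revert x
    decide

theorem dihedralSign_reverse (u : List (Fin 3)) : dihedralSign u.reverse = dihedralSign u := by
  induction u with
  | nil => rfl
  | cons x u ih =>
    rw [List.reverse_cons, dihedralSign_append, ih, dihedralSign, dihedralSign, dihedralSign]
    ring

theorem dihedralShift_reverse (u : List (Fin 3)) :
    dihedralShift u.reverse = -(dihedralSign u * dihedralShift u) := by
  induction u with
  | nil => rfl
  | cons x u ih =>
    rw [List.reverse_cons, dihedralShift_append, ih, dihedralSign_reverse, dihedralSign,
      dihedralShift, dihedralShift, dihedralShift]
    fin_cases x <;> simp <;> ring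

/-- The shift of a word is a signed sum of the shifts of its sections. -/
theorem dihedralShift_eq (u : List (Fin 3)) :
    dihedralShift u = dihedralShift (wordSection 0 u) + dihedralShift (wordSection 1 u) -
      dihedralShift (wordSection 2 u) := by
  induction u with
  | nil => rfl
  | cons x u ih =>
    rw [dihedralShift, ih]
    fin_cases x <;> simp [wordSection, dihedralShift] <;> ring

theorem wordSection_eq_or_length_lt (v : Fin 3) (u : List (Fin 3)) :
    (wordSection v u).length < u.length ∨ wordSection v u = u ∧ u = List.replicate u.length v := by
  induction u generalizing v with
  | nil => exact Or.inr ⟨rfl, rfl⟩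
  | cons x u ih =>
    rw [wordSection]
    split_ifs with h
    · subst h
      rcases ih v with h1 | ⟨h1, h2⟩
      · exact Or.inl (by simpa using h1)
      · exact Or.inr ⟨by rw [h1], by rw [List.length_cons, List.replicate_succ, ← h2]⟩
    · left
      rcases ih (Equiv.swap (x + 1) (x + 2) v) with h1 | ⟨h1, -⟩
      · exact h1.trans (by simp)
      · rw [h1]
        simp

/-- The shift of a power of a generator that is trivial in the group. -/
theorem dihedralShift_replicate {k : ℕ} {v : Fin 3}
    (h : wordEval (List.replicate k v) = 1) : dihedralShift (List.replicate k v) = 0 := by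
  have h1 : ∀ m : ℕ, wordEval (List.replicate (m + m) v) = 1 ∧
      dihedralShift (List.replicate (m + m) v) = 0 := by
    intro m
    rw [List.replicate_add, wordEval_append, dihedralShift_append]
    have h2 : wordEval (List.replicate m v) * wordEval (List.replicate m v) = 1 := by
      conv_lhs => enter [1]; rw [← List.reverse_replicate, wordEval_reverse]
      exact inv_mul_cancel _
    refine ⟨h2, ?_⟩
    have h3 := dihedralShift_reverse (List.replicate m v)
    rw [List.reverse_replicate] at h3
    linear_combination h3
  rcases Nat.even_or_odd' k with ⟨m, rfl | rfl⟩
  · rw [two_mul]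
    exact (h1 m).2
  · rw [two_mul, List.replicate_succ, wordEval, (h1 m).1, one_mul] at h
    have h5 := rootSign_hanoiGen v
    rw [h, map_one] at h5
    exact absurd h5 (by decide)

/-- A word that is trivial in the Hanoi group has trivial shift: its sections are trivial and, up
to powers of generators, shorter. -/
theorem dihedralShift_eq_zero {u : List (Fin 3)} (hu : wordEval u = 1) : dihedralShift u = 0 := by
  induction hn : u.length using Nat.strong_induction_on generalizing u with
  | _ n ih =>
    have h1 : ∀ v, wordEval (wordSection v u) = 1 := by
      intro v
      ext1 w
      have h2 := wordEval_app_cons u v w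
      rw [hu, app_one, List.cons.injEq] at h2
      exact h2.2.symm
    have h3 : ∀ v, dihedralShift (wordSection v u) = 0 := by
      intro v
      rcases wordSection_eq_or_length_lt v u with h | ⟨h, h'⟩
      · exact ih _ (by rw [← hn]; exact h) (h1 v) rfl
      · rw [h, h']
        exact dihedralShift_replicate (by rw [← h']; exact hu)
    rw [dihedralShift_eq, h3, h3, h3]
    rfl

/-- The kernel of the homomorphism from the Hanoi group to the infinite dihedral group that kills
the generator of the peg `2` and sends the other two generators to different reflections. -/
def dihedralKernel : Subgroup ↥hanoiGroup where
  carrier := {g | ∃ u, wordEval u = g ∧ dihedralSign u = 1 ∧ dihedralShift u = 0}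
  one_mem' := ⟨[], rfl, rfl, rfl⟩
  mul_mem' := by
    rintro g h ⟨u, hu, hu1, hu2⟩ ⟨v, hv, hv1, hv2⟩
    refine ⟨v ++ u, ?_, ?_, ?_⟩
    · rw [wordEval_append, hu, hv]
      rfl
    · rw [dihedralSign_append, hu1, hv1, one_mul]
    · rw [dihedralShift_append, hu2, hv2, mul_zero, add_zero]
  inv_mem' := by
    rintro g ⟨u, hu, hu1, hu2⟩
    refine ⟨u.reverse, ?_, ?_, ?_⟩
    · rw [wordEval_reverse, hu]
      rfl
    · rw [dihedralSign_reverse, hu1]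
    · rw [dihedralShift_reverse, hu2, mul_zero, neg_zero]

theorem dihedralKernel_normal : dihedralKernel.Normal := by
  refine ⟨?_⟩
  rintro g ⟨u, hu, hu1, hu2⟩ h
  obtain ⟨v, hv⟩ := exists_wordEval_eq h.2
  refine ⟨v.reverse ++ (u ++ v), ?_, ?_, ?_⟩
  · rw [wordEval_append, wordEval_append, wordEval_reverse, hu, hv]
    rfl
  · rw [dihedralSign_append, dihedralSign_append, hu1, one_mul, dihedralSign_reverse,
      dihedralSign_mul_self]
  · rw [dihedralShift_append, dihedralShift_append, dihedralSign_reverse, dihedralShift_reverse,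
      hu1, hu2]
    ring

theorem dihedralKernel_ne_bot : dihedralKernel ≠ ⊥ := by
  intro h
  have h1 : (⟨hanoiGen 2, hanoiGen_mem 2⟩ : ↥hanoiGroup) ∈ dihedralKernel :=
    ⟨[2], by simp [wordEval], by decide, by decide⟩
  rw [h, Subgroup.mem_bot] at h1
  have h2 := rootSign_hanoiGen 2
  rw [show hanoiGen 2 = 1 from congrArg Subtype.val h1, map_one] at h2
  exact absurd h2 (by decide)

/-- The product of the first two generators has infinite order modulo the kernel. -/
theorem not_finiteIndex_dihedralKernel : ¬ dihedralKernel.FiniteIndex := by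
  intro hfin
  obtain ⟨m, hm, -, u, hu, hu1, hu2⟩ := Subgroup.exists_pow_mem_of_index_ne_zero
    hfin.index_ne_zero ⟨wordEval [0, 1], wordEval_mem _⟩
  have h1 : ∀ n : ℕ, ∃ w, wordEval w = wordEval [0, 1] ^ n ∧ dihedralSign w = 1 ∧
      dihedralShift w = 2 * n := by
    intro n
    induction n with
    | zero => exact ⟨[], rfl, rfl, rfl⟩
    | succ n ih =>
      obtain ⟨w, h1, h2, h3⟩ := ih
      refine ⟨[0, 1] ++ w, ?_, ?_, ?_⟩
      · rw [wordEval_append, h1, pow_succ]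
      · rw [dihedralSign_append, h2]
        rfl
      · rw [dihedralShift_append, h3]
        simp [dihedralShift, dihedralSign]
        ring
  obtain ⟨w, hw, hw1, hw2⟩ := h1 m
  have h2 : wordEval (u ++ w.reverse) = 1 := by
    rw [wordEval_append, wordEval_reverse, hw, hu]
    exact inv_mul_cancel _
  have h3 := dihedralShift_eq_zero h2
  rw [dihedralShift_append, dihedralShift_reverse, hu1, hu2, hw1, hw2] at h3
  omega

theorem infinite_hanoiGroup : Infinite ↥hanoiGroup := by
  refine not_finite_iff_infinite.1 fun h => ?_
  exact not_finiteIndex_dihedralKernel inferInstance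

theorem not_isJustInfinite_hanoiGroup : ¬ IsJustInfinite ↥hanoiGroup := fun h =>
  not_finiteIndex_dihedralKernel (h.2 _ dihedralKernel_normal dihedralKernel_ne_bot)

theorem infinite_parityGroup : Infinite ↥(parityGroup (Fin 3)) :=
  have := infinite_hanoiGroup
  Infinite.of_injective _ (Subgroup.inclusion_injective hanoiGroup_le)

end Dihedral

end TreeAut

theorem corollary1p4 :
    IsLeast {D : ℕ | TreeAut.IsFiniteTypeOfDepth hanoiGroup.topologicalClosure D} 2 ∧
    IsTopJustInfinite ↥hanoiGroup.topologicalClosure ∧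
    IsStronglyComplete ↥hanoiGroup.topologicalClosure ∧
    Infinite ↥hanoiGroup ∧ ¬ IsJustInfinite ↥hanoiGroup := by
  rw [TreeAut.topologicalClosure_hanoiGroup]
  exact ⟨TreeAut.isLeast_depth_parityGroup,
    TreeAut.isTopJustInfinite_parityGroup TreeAut.infinite_parityGroup,
    TreeAut.isStronglyComplete_parityGroup TreeAut.infinite_parityGroup,
    TreeAut.infinite_hanoiGroup, TreeAut.not_isJustInfinite_hanoiGroup⟩
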